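/- Let $(a,b)\subset\mathbb{R}$ be a finite interval, let $n\in\mathbb{N}\cup\{0\}$, $m,r,l\in\mathbb{N}$ (positive) and $1\le p\le\infty$. For $s\ge 1$ let $W_p^{s}$ be the complex Sobolev space of all $y\in C^{s-1}([a,b];\mathbb{C})$ such that $y^{(s-1)}$ is absolutely continuous on $[a,b]$ and $y^{(s)}\in L_p[a,b]$, put $W_p^0:=L_p[a,b]$, and endow $W_p^s$ with the norm $\|y\|_{s,p}=\sum_{k=0}^{s}\|y^{(k)}\|_{L_p}$. Given matrix-valued functions $A_{0},\dots,A_{r-1}\in (W_p^n)^{m\times m}$ and a continuous linear operator $B\colon (W_p^{n+r})^m\to\mathbb{C}^l$, consider the boundary-value problem $$ (Ly)(t):=y^{(r)}(t)+\sum_{j=1}^{r}A_{r-j}(t)\,y^{(r-j)}(t)=f(t),\quad t\in(a,b),\qquad By=c, $$ with $f\in(W_p^n)^m$, $c\in\mathbb{C}^l$ and unknown $y\in(W_p^{n+r})^m$, where the differential equation is required to hold everywhere on $(a,b)$ if $n\ge1$ and almost everywhere on $(a,b)$ if $n=0$. For every $k\in\mathbb{N}$ let $A_{0}(\cdot,k),\dots,A_{r-1}(\cdot,k)\in(W_p^n)^{m\times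 m}$ and a continuous linear operator $B(k)\colon (W_p^{n+r})^m\to\mathbb{C}^l$ be given as well, and let $L(k)$ be the differential expression with the coefficients $A_{r-j}(\cdot,k)$. Suppose that the operators $(L(k),B(k))\colon (W_p^{n+r})^m\to(W_p^n)^m\times\mathbb{C}^l$ converge strongly to $(L,B)$, i.e. $(L(k)y,B(k)y)\to(Ly,By)$ in $(W_p^n)^m\times\mathbb{C}^l$ as $k\to\infty$ for every $y\in(W_p^{n+r})^m$. If the homogeneous problem $Ly=0$, $By=0$ has only the trivial solution $y=0$ in $(W_p^{n+r})^m$, then for all sufficiently large $k$ the homogeneous problem $L(k)y=0$, $B(k)y=0$ has only the trivial solution $y=0$ in $(W_p^{n+r})^m$. -/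

import Mathlib

open MeasureTheory Set Filter Topology
open scoped ENNReal

/-- Lebesgue measure on the interval `[a, b]`. -/
noncomputable abbrev intervalMeasure (a b : ℝ) : Measure ℝ := volume.restrict (Icc a b)

/-- Membership of a complex function on `[a, b]` in the Sobolev space `W_p^s([a,b]; ℂ)`.
For `s = 0` this is `L_p`; for `s ≥ 1` it says that `y ∈ C^{s-1}[a,b]`, that `y^{(s-1)}` is absolutely
continuous on `[a, b]` and that `y^{(s)}` (which exists almost everywhere) belongs to `L_p`.
A function on `[a, b]` is represented by a function on `ℝ`; its values outside `[a, b]` play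
no role, and the derivatives are those of the restriction to `[a, b]` (one-sided at the ends). -/
def IsSobolev (a b : ℝ) (p : ℝ≥0∞) : ℕ → (ℝ → ℂ) → Prop
  | 0, y => MemLp y p (intervalMeasure a b)
  | s + 1, y => ContDiffOn ℝ s y (Icc a b) ∧
      AbsolutelyContinuousOnInterval (iteratedDerivWithin s y (Icc a b)) a b ∧
      MemLp (iteratedDerivWithin (s + 1) y (Icc a b)) p (intervalMeasure a b)

namespace IsSobolev

variable {a b : ℝ} {p : ℝ≥0∞}

theorem one_iff {y : ℝ → ℂ} : IsSobolev a b p 1 y ↔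
    AbsolutelyContinuousOnInterval y a b ∧
      MemLp (derivWithin y (Icc a b)) p (intervalMeasure a b) := by
  have h1 : iteratedDerivWithin 1 y (Icc a b) = derivWithin y (Icc a b) := by
    exact iteratedDerivWithin_one
  simp only [IsSobolev, iteratedDerivWithin_zero, zero_add, h1]
  constructor
  · exact fun h => h.2
  · intro h
    refine ⟨?_, h⟩
    have := h.1.continuousOn.mono Icc_subset_uIcc
    simpa [contDiffOn_zero] using this

theorem iteratedDerivWithin_succ_fun (s : ℕ) (y : ℝ → ℂ) :
    iteratedDerivWithin (s + 1) y (Icc a b) =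
      iteratedDerivWithin s (derivWithin y (Icc a b)) (Icc a b) := by
  exact iteratedDerivWithin_succ'

theorem succ_succ_iff (hab : a < b) {s : ℕ} {y : ℝ → ℂ} : IsSobolev a b p (s + 2) y ↔
    DifferentiableOn ℝ y (Icc a b) ∧ IsSobolev a b p (s + 1) (derivWithin y (Icc a b)) := by
  simp only [IsSobolev]
  rw [iteratedDerivWithin_succ_fun (s + 1), iteratedDerivWithin_succ_fun s]
  have : ((s + 1 : ℕ) : WithTop ℕ∞) = (s : WithTop ℕ∞) + 1 := by push_cast; rfl
  rw [this, contDiffOn_succ_iff_derivWithin (uniqueDiffOn_Icc hab)]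
  constructor
  · rintro ⟨⟨h1, -, h2⟩, h3⟩; exact ⟨h1, h2, h3⟩
  · rintro ⟨h1, h2, h3⟩
    exact ⟨⟨h1, fun h => absurd h (by simp), h2⟩, h3⟩

theorem memLp_of_continuousOn {y : ℝ → ℂ} (h : ContinuousOn y (Icc a b)) :
    MemLp y p (intervalMeasure a b) := by
  obtain ⟨C, hC⟩ := isCompact_Icc.exists_bound_of_continuousOn h
  refine MemLp.of_bound (h.aestronglyMeasurable measurableSet_Icc) C ?_
  exact (ae_restrict_iff' measurableSet_Icc).2 (Eventually.of_forall hC)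

theorem continuousOn {s : ℕ} {y : ℝ → ℂ} (h : IsSobolev a b p (s + 1) y) :
    ContinuousOn y (Icc a b) := h.1.continuousOn

theorem mono_succ (hab : a < b) {s : ℕ} {y : ℝ → ℂ} (h : IsSobolev a b p (s + 1) y) :
    IsSobolev a b p s y := by
  induction s generalizing y with
  | zero => exact memLp_of_continuousOn h.continuousOn
  | succ s ih =>
    rw [succ_succ_iff hab] at h
    cases s with
    | zero =>
      rw [zero_add, one_iff]
      have hc := h.2.continuousOn
      refine ⟨?_, memLp_of_continuousOn hc⟩
      have : ContDiffOn ℝ 1 y (Icc a b) := by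
        have h01 : (1 : WithTop ℕ∞) = 0 + 1 := by simp
        rw [h01, contDiffOn_succ_iff_derivWithin (uniqueDiffOn_Icc hab)]
        exact ⟨h.1, fun h => absurd h (by simp), contDiffOn_zero.2 hc⟩
      rw [← uIcc_of_le hab.le] at this
      exact this.absolutelyContinuousOnInterval
    | succ s =>
      rw [succ_succ_iff hab]
      exact ⟨h.1, ih h.2⟩

theorem mono_add (hab : a < b) {s : ℕ} (j : ℕ) {y : ℝ → ℂ} (h : IsSobolev a b p (s + j) y) :
    IsSobolev a b p s y := by
  induction j with
  | zero => exact h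
  | succ j ih => exact ih (mono_succ hab h)

theorem derivWithin (hab : a < b) {s : ℕ} {y : ℝ → ℂ} (h : IsSobolev a b p (s + 1) y) :
    IsSobolev a b p s (derivWithin y (Icc a b)) := by
  cases s with
  | zero => exact (one_iff.1 h).2
  | succ s => exact ((succ_succ_iff hab).1 h).2

theorem iteratedDerivWithin (hab : a < b) {s : ℕ} (j : ℕ) {y : ℝ → ℂ}
    (h : IsSobolev a b p (s + j) y) : IsSobolev a b p s (iteratedDerivWithin j y (Icc a b)) := by
  induction j generalizing y with
  | zero => simpa using h
  | succ j ih =>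
    rw [iteratedDerivWithin_succ_fun]
    exact ih (derivWithin hab h)

theorem memLp (hab : a < b) {s : ℕ} {y : ℝ → ℂ} (h : IsSobolev a b p s y) :
    MemLp y p (intervalMeasure a b) :=
  mono_add (s := 0) hab s (by simpa using h)

theorem memLp_iteratedDerivWithin (hab : a < b) {s k : ℕ} (hk : k ≤ s) {y : ℝ → ℂ}
    (h : IsSobolev a b p s y) :
    MemLp (_root_.iteratedDerivWithin k y (Icc a b)) p (intervalMeasure a b) := by
  obtain ⟨j, rfl⟩ := Nat.exists_eq_add_of_le' hk
  exact (iteratedDerivWithin hab k h).memLp hab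

/-- Up to order `s`, the derivatives of functions of class `W_p^s` exist almost everywhere. -/
theorem ae_differentiableWithinAt {y : ℝ → ℂ} (h : IsSobolev a b p 1 y) :
    ∀ᵐ t ∂(intervalMeasure a b), DifferentiableWithinAt ℝ y (Icc a b) t := by
  rw [ae_restrict_iff' measurableSet_Icc]
  filter_upwards [(one_iff.1 h).1.boundedVariationOn.ae_differentiableAt_of_mem_uIcc] with t ht hm
  exact (ht (Icc_subset_uIcc hm)).differentiableWithinAt

theorem congr (hab : a < b) {s : ℕ} {y z : ℝ → ℂ} (h : IsSobolev a b p (s + 1) y)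
    (e : EqOn z y (Icc a b)) : IsSobolev a b p (s + 1) z := by
  refine ⟨h.1.congr e, ?_, ?_⟩
  · have := h.2.1
    have e2 := iteratedDerivWithin_congr (n := s) (𝕜 := ℝ) e
    rw [absolutelyContinuousOnInterval_iff] at this ⊢
    intro ε hε
    obtain ⟨δ, hδ, H⟩ := this ε hε
    refine ⟨δ, hδ, fun E hE hs => ?_⟩
    have := H E hE hs
    convert this using 1
    refine Finset.sum_congr rfl fun i hi => ?_
    have := hE.1 i hi
    rw [uIcc_of_le hab.le] at this
    rw [e2 this.1, e2 this.2]
  · refine h.2.2.ae_eq ?_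
    rw [EventuallyEq, ae_restrict_iff' measurableSet_Icc]
    exact Eventually.of_forall fun t ht => (iteratedDerivWithin_congr e ht).symm

theorem add (hab : a < b) {s : ℕ} {y z : ℝ → ℂ} (hy : IsSobolev a b p s y)
    (hz : IsSobolev a b p s z) : IsSobolev a b p s (y + z) := by
  induction s generalizing y z with
  | zero => exact MemLp.add hy hz
  | succ s ih =>
    cases s with
    | zero =>
      have hdy := ae_differentiableWithinAt hy
      have hdz := ae_differentiableWithinAt hz
      rw [zero_add, one_iff] at hy hz ⊢
      refine ⟨hy.1.add hz.1, (hy.2.add hz.2).ae_eq ?_⟩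
      filter_upwards [hdy, hdz] with t h1 h2
      exact (derivWithin_add h1 h2).symm
    | succ s =>
      rw [succ_succ_iff hab] at hy hz ⊢
      refine ⟨hy.1.add hz.1, (ih hy.2 hz.2).congr hab fun t ht => ?_⟩
      exact derivWithin_add (hy.1 t ht) (hz.1 t ht)

theorem const_smul (c : ℂ) {s : ℕ} {y : ℝ → ℂ} (hy : IsSobolev a b p s y) :
    IsSobolev a b p s (c • y) := by
  cases s with
  | zero => exact MemLp.const_smul hy c
  | succ s =>
    have e : ∀ k, _root_.iteratedDerivWithin k (c • y) (Icc a b) =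
        fun t => c • _root_.iteratedDerivWithin k y (Icc a b) t := fun k => by
      funext t; simp [iteratedDerivWithin_const_smul_field]
    refine ⟨hy.1.const_smul c, ?_, ?_⟩
    · rw [e]; exact hy.2.1.const_smul c
    · rw [e]; exact hy.2.2.const_smul c

theorem zero {s : ℕ} : IsSobolev a b p s 0 := by
  have e : ∀ k, _root_.iteratedDerivWithin k (0 : ℝ → ℂ) (Icc a b) = 0 := fun k => by
    funext t; simp
  cases s with
  | zero => exact MemLp.zero
  | succ s =>
    refine ⟨contDiffOn_const, ?_, ?_⟩
    · rw [e, absolutelyContinuousOnInterval_iff]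
      exact fun ε hε => ⟨1, one_pos, fun E _ _ => by simpa using hε⟩
    · rw [e]; exact MemLp.zero

/-- The product of a function of class `W_p^s` and a function of class `W_p^{s+1}` is of
class `W_p^s`. -/
theorem mul (hab : a < b) {s : ℕ} {y z : ℝ → ℂ} (hy : IsSobolev a b p s y)
    (hz : IsSobolev a b p (s + 1) z) : IsSobolev a b p s (y * z) := by
  have base : ∀ {y z : ℝ → ℂ}, MemLp y p (intervalMeasure a b) →
      ContinuousOn z (Icc a b) → MemLp (y * z) p (intervalMeasure a b) := fun hy hz =>
    (memLp_of_continuousOn (p := ∞) hz).mul hy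
  induction s generalizing y z with
  | zero => exact base hy hz.continuousOn
  | succ s ih =>
    have hz1 := mono_succ hab hz
    cases s with
    | zero =>
      have hdy := ae_differentiableWithinAt hy
      have hdz := ae_differentiableWithinAt hz1
      have hyc := hy.continuousOn
      have hzc := hz.continuousOn
      rw [zero_add, one_iff] at hy hz1 ⊢
      refine ⟨hy.1.smul hz1.1, ((base hy.2 hzc).add (base hz1.2 hyc)).ae_eq ?_⟩
      filter_upwards [hdy, hdz] with t h1 h2
      rw [derivWithin_mul h1 h2]
      simp [mul_comm]
    | succ s =>
      have hdz := derivWithin hab hz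
      have h3 := ih (mono_succ hab hdz) hy
      rw [succ_succ_iff hab] at hy hz1 ⊢
      refine ⟨hy.1.mul hz1.1, ((ih hy.2 (mono_succ hab hz)).add hab h3).congr hab
        fun t ht => ?_⟩
      rw [derivWithin_mul (hy.1 t ht) (hz1.1 t ht)]
      simp [mul_comm]

theorem sum (hab : a < b) {ι : Type*} (S : Finset ι) {s : ℕ} {y : ι → ℝ → ℂ}
    (hy : ∀ i, IsSobolev a b p s (y i)) : IsSobolev a b p s (∑ i ∈ S, y i) := by
  classical
  induction S using Finset.induction_on with
  | empty => simpa using zero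
  | insert i S hi ih => rw [Finset.sum_insert hi]; exact (hy i).add hab ih

/-- Up to order `s`, the derivatives of functions of class `W_p^s` are additive almost
everywhere. -/
theorem iteratedDerivWithin_add_ae (hab : a < b) {s k : ℕ} (hk : k ≤ s) {y z : ℝ → ℂ}
    (hy : IsSobolev a b p s y) (hz : IsSobolev a b p s z) :
    _root_.iteratedDerivWithin k (y + z) (Icc a b) =ᵐ[intervalMeasure a b]
      _root_.iteratedDerivWithin k y (Icc a b) + _root_.iteratedDerivWithin k z (Icc a b) := by
  obtain ⟨j, rfl⟩ := Nat.exists_eq_add_of_le' hk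
  cases k with
  | zero => simp
  | succ k =>
    have hy' : IsSobolev a b p (1 + k) y := mono_add hab j (by convert hy using 1; ring)
    have hz' : IsSobolev a b p (1 + k) z := mono_add hab j (by convert hz using 1; ring)
    have hdy := ae_differentiableWithinAt (iteratedDerivWithin hab k hy')
    have hdz := ae_differentiableWithinAt (iteratedDerivWithin hab k hz')
    rw [Nat.add_comm 1 k] at hy' hz'
    filter_upwards [hdy, hdz, ae_restrict_mem measurableSet_Icc] with t h1 h2 ht
    have e : EqOn (_root_.iteratedDerivWithin k (y + z) (Icc a b))
        (_root_.iteratedDerivWithin k y (Icc a b) + _root_.iteratedDerivWithin k z (Icc a b))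
        (Icc a b) := fun x hx =>
      iteratedDerivWithin_add hx (uniqueDiffOn_Icc hab) (hy'.1 x hx) (hz'.1 x hx)
    simp only [Pi.add_apply, iteratedDerivWithin_succ]
    rw [derivWithin_congr e (e ht), derivWithin_add h1 h2]

end IsSobolev

/-- The functions of class `W_p^s` on `[a, b]` form a complex vector space. -/
def sobolevSubmodule (a b : ℝ) [hab : Fact (a < b)] (p : ℝ≥0∞) (s : ℕ) :
    Submodule ℂ (ℝ → ℂ) where
  carrier := {y | IsSobolev a b p s y}
  add_mem' hy hz := IsSobolev.add hab.out hy hz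
  zero_mem' := IsSobolev.zero
  smul_mem' c _ hy := IsSobolev.const_smul c hy

/-- The Sobolev space `W_p^s([a,b]; ℂ)`. Its topology is that of the norm
`‖y‖_{s,p} = ∑_{k ≤ s} ‖y^{(k)}‖_p` below. Elements are functions; two of them at distance zero
(which for `s ≥ 1` means that they coincide on `[a, b]`, and for `s = 0` that they coincide almost
everywhere on `[a, b]`) are to be identified. -/
def SobolevSpace (a b : ℝ) [Fact (a < b)] (p : ℝ≥0∞) (s : ℕ) : Type :=
  ↥(sobolevSubmodule a b p s)

namespace SobolevSpace

variable {a b : ℝ} [hab : Fact (a < b)] {p : ℝ≥0∞} {s : ℕ}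

noncomputable instance : AddCommGroup (SobolevSpace a b p s) :=
  inferInstanceAs (AddCommGroup ↥(sobolevSubmodule a b p s))

noncomputable instance : Module ℂ (SobolevSpace a b p s) :=
  inferInstanceAs (Module ℂ ↥(sobolevSubmodule a b p s))

instance : CoeFun (SobolevSpace a b p s) (fun _ => ℝ → ℂ) := ⟨fun y => y.1⟩

/-- The derivative `y^{(k)}` on `[a, b]`. -/
noncomputable def deriv (k : ℕ) (y : SobolevSpace a b p s) : ℝ → ℂ :=
  iteratedDerivWithin k (fun t => y t) (Icc a b)

/-- The norm `‖y‖_{s,p} = ∑_{k ≤ s} ‖y^{(k)}‖_p`. -/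
noncomputable instance : Norm (SobolevSpace a b p s) :=
  ⟨fun y => ∑ k ∈ Finset.range (s + 1), (eLpNorm (y.deriv k) p (intervalMeasure a b)).toReal⟩

theorem norm_def (y : SobolevSpace a b p s) : ‖y‖ =
    ∑ k ∈ Finset.range (s + 1), (eLpNorm (y.deriv k) p (intervalMeasure a b)).toReal := rfl

theorem memLp_deriv {k : ℕ} (hk : k ≤ s) (y : SobolevSpace a b p s) :
    MemLp (y.deriv k) p (intervalMeasure a b) :=
  IsSobolev.memLp_iteratedDerivWithin hab.out hk y.2

theorem norm_smul_eq (c : ℂ) (y : SobolevSpace a b p s) : ‖c • y‖ = ‖c‖ * ‖y‖ := by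
  rw [norm_def, norm_def, Finset.mul_sum]
  refine Finset.sum_congr rfl fun k _ => ?_
  have e : (c • y).deriv k = c • y.deriv k := by
    funext t
    exact iteratedDerivWithin_const_smul_field c _
  rw [e, eLpNorm_const_smul, ENNReal.toReal_mul]
  simp

theorem norm_add_le' [hp : Fact (1 ≤ p)] (y z : SobolevSpace a b p s) :
    ‖y + z‖ ≤ ‖y‖ + ‖z‖ := by
  rw [norm_def, norm_def, norm_def, ← Finset.sum_add_distrib]
  refine Finset.sum_le_sum fun k hk => ?_
  have hk : k ≤ s := Nat.lt_succ_iff.1 (Finset.mem_range.1 hk)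
  have e : (y + z).deriv k =ᵐ[intervalMeasure a b] y.deriv k + z.deriv k :=
    IsSobolev.iteratedDerivWithin_add_ae hab.out hk y.2 z.2
  have hy := y.memLp_deriv hk
  have hz := z.memLp_deriv hk
  rw [eLpNorm_congr_ae e, ← ENNReal.toReal_add hy.2.ne hz.2.ne]
  exact ENNReal.toReal_mono (ENNReal.add_ne_top.2 ⟨hy.2.ne, hz.2.ne⟩)
    (eLpNorm_add_le hy.1 hz.1 hp.out)

noncomputable instance [Fact (1 ≤ p)] : SeminormedAddCommGroup (SobolevSpace a b p s) :=
  SeminormedAddCommGroup.ofCore (𝕜 := ℂ)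
    { norm_nonneg := fun _ => Finset.sum_nonneg fun _ _ => ENNReal.toReal_nonneg
      norm_smul := norm_smul_eq
      norm_triangle := norm_add_le' }

noncomputable instance [Fact (1 ≤ p)] : NormedSpace ℂ (SobolevSpace a b p s) where
  norm_smul_le c y := (norm_smul_eq c y).le

end SobolevSpace

section BoundaryValueProblem

variable {a b : ℝ} [hab : Fact (a < b)] {p : ℝ≥0∞} {n m r l : ℕ}

/-- The differential expression
`(L y)(t) = y^{(r)}(t) + ∑_{j=1}^{r} A_{r-j}(t) y^{(r-j)}(t)` as an operator from `(W_p^{n+r})^m` to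
`(W_p^n)^m`, with matrix-valued coefficients `A_0, …, A_{r-1}` in `(W_p^n)^{m × m}`; here `A j` is the
coefficient of `y^{(j)}`. The topology on `(W_p^s)^m` is the product topology, which is also the one
given by the sum of the norms of the components. -/
noncomputable def diffOp (A : Fin r → Matrix (Fin m) (Fin m) (SobolevSpace a b p n))
    (y : Fin m → SobolevSpace a b p (n + r)) : Fin m → SobolevSpace a b p n := fun i =>
  ⟨(y i).deriv r + ∑ j : Fin r, ∑ i' : Fin m, (A j i i' : ℝ → ℂ) * (y i').deriv j, by
    refine IsSobolev.add hab.out (IsSobolev.iteratedDerivWithin hab.out r (y i).2) ?_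
    refine IsSobolev.sum hab.out _ fun j => IsSobolev.sum hab.out _ fun i' => ?_
    refine IsSobolev.mul hab.out (A j i i').2 (IsSobolev.iteratedDerivWithin hab.out j ?_)
    refine IsSobolev.mono_add hab.out (r - 1 - j) ?_
    have h : n + 1 + (j : ℕ) + (r - 1 - j) = n + r := by have := j.2; omega
    rw [h]
    exact (y i').2⟩

variable [Fact (1 ≤ p)]

/-- The operator `(L, B)` from `(W_p^{n+r})^m` to `(W_p^n)^m × ℂ^l`. -/
noncomputable def bvpOp (A : Fin r → Matrix (Fin m) (Fin m) (SobolevSpace a b p n))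
    (B : (Fin m → SobolevSpace a b p (n + r)) →L[ℂ] (Fin l → ℂ))
    (y : Fin m → SobolevSpace a b p (n + r)) : (Fin m → SobolevSpace a b p n) × (Fin l → ℂ) :=
  (diffOp A y, B y)

/-- `y` solves the boundary-value problem `L y = f`, `B y = c`: the differential equation holds
everywhere on `(a, b)` if `n ≥ 1`, and almost everywhere on `(a, b)` if `n = 0`. -/
def IsSolution (A : Fin r → Matrix (Fin m) (Fin m) (SobolevSpace a b p n))
    (B : (Fin m → SobolevSpace a b p (n + r)) →L[ℂ] (Fin l → ℂ))
    (f : Fin m → SobolevSpace a b p n) (c : Fin l → ℂ)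
    (y : Fin m → SobolevSpace a b p (n + r)) : Prop :=
  (1 ≤ n → ∀ t ∈ Ioo a b, ∀ i, diffOp A y i t = f i t) ∧
  (n = 0 → ∀ᵐ t ∂(volume.restrict (Ioo a b)), ∀ i, diffOp A y i t = f i t) ∧
  B y = c

/-- The homogeneous problem `L y = 0`, `B y = 0` has only the trivial solution. -/
def HasOnlyTrivialSolution (A : Fin r → Matrix (Fin m) (Fin m) (SobolevSpace a b p n))
    (B : (Fin m → SobolevSpace a b p (n + r)) →L[ℂ] (Fin l → ℂ)) : Prop :=
  ∀ y : Fin m → SobolevSpace a b p (n + r), IsSolution A B 0 0 y →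
    ∀ i, ∀ t ∈ Icc a b, y i t = 0

end BoundaryValueProblem

/-!
# Stability of unique solvability of inhomogeneous boundary-value problems

If the homogeneous limit problem has only the trivial solution, then so do the homogeneous
approximating problems, for all large `k`. The argument is by compactness.

The heart is an a priori estimate for the fixed limit operator (`exists_sum_sobolevNorm_le`,
`exists_data_estimate`): the norm of `y` in `(W_p^{n+r})^m` is bounded by a constant times
`‖L y‖` plus the derivatives of `y` of orders below `r` at finitely many points. For `n = 0` the
points are chosen so close to each other that the coefficients, which are only integrable, have
small integral in between, and the lower-order terms are absorbed; for larger `n` the equation is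
used to gain one order of regularity at a time, by the boundedness of multiplication in `W_p^s`
(`exists_sobolevNorm_mul_le`, `exists_sobolevNorm_succ_mul_le`).

Testing strong convergence on monomials gives `A_j(·, k) → A_j` in `W_p^n`
(`tendsto_sobolevNorm_coefficient`), so that `L(k) → L` uniformly on bounded sets
(`exists_diffSeminorm_le_of_tendsto`). The operators `B(k)` are uniformly bounded by the
Banach–Steinhaus theorem, which needs the completeness of `W_p^s`
(`SobolevSpace.completeSpace`).

If now `y_k` are kernel elements of `(L(k), B(k))` of norm one for infinitely many `k`, then
`L y_k → 0`, and along a subsequence their finitely many point values converge; by the a priori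
estimate this subsequence is Cauchy, and its limit is a kernel element of `(L, B)` of norm one
(`eventually_norm_eq_zero_of_estimate`). No existence theorem for the Cauchy problem is used.
-/

/-- The norm `∑_{k ≤ s} ‖y^{(k)}‖_p` of `W_p^s` as a function of a plain function `y`. On
`SobolevSpace a b p s` it is definitionally the norm; stating estimates for plain functions avoids
transporting elements between the spaces of different orders. -/
noncomputable def sobolevNorm (a b : ℝ) (p : ℝ≥0∞) (s : ℕ) (y : ℝ → ℂ) : ℝ :=
  ∑ k ∈ Finset.range (s + 1),
    (eLpNorm (iteratedDerivWithin k y (Icc a b)) p (intervalMeasure a b)).toReal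

/-! ### The Sobolev norm of a plain function -/

section Norm

variable {a b : ℝ} {p : ℝ≥0∞} {s : ℕ} {y z : ℝ → ℂ}

theorem sobolevNorm_nonneg : 0 ≤ sobolevNorm a b p s y :=
  Finset.sum_nonneg fun _ _ => ENNReal.toReal_nonneg

theorem sobolevNorm_zero : sobolevNorm a b p 0 y = (eLpNorm y p (intervalMeasure a b)).toReal := by
  simp [sobolevNorm]

theorem sobolevNorm_succ : sobolevNorm a b p (s + 1) y =
    (eLpNorm y p (intervalMeasure a b)).toReal + sobolevNorm a b p s (derivWithin y (Icc a b)) := by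
  rw [sobolevNorm, Finset.sum_range_succ', add_comm, sobolevNorm]
  simp only [iteratedDerivWithin_zero, IsSobolev.iteratedDerivWithin_succ_fun]

theorem sobolevNorm_add_order (r : ℕ) : sobolevNorm a b p (s + r) y =
    ∑ k ∈ Finset.range r,
      (eLpNorm (iteratedDerivWithin k y (Icc a b)) p (intervalMeasure a b)).toReal +
      sobolevNorm a b p s (iteratedDerivWithin r y (Icc a b)) := by
  induction r generalizing y with
  | zero => simp
  | succ r ih =>
    rw [← add_assoc, sobolevNorm_succ, ih, Finset.sum_range_succ' _ r]
    simp only [IsSobolev.iteratedDerivWithin_succ_fun, iteratedDerivWithin_zero]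
    ring

theorem sobolevNorm_mono (j : ℕ) : sobolevNorm a b p s y ≤ sobolevNorm a b p (s + j) y := by
  refine Finset.sum_le_sum_of_subset_of_nonneg ?_ fun _ _ _ => ENNReal.toReal_nonneg
  exact Finset.range_subset_range.2 (by omega)

theorem sobolevNorm_one_le : sobolevNorm a b p 1 y ≤ sobolevNorm a b p (s + 1) y := by
  rw [add_comm]
  exact sobolevNorm_mono s

theorem sobolevNorm_iteratedDerivWithin_le (j : ℕ) :
    sobolevNorm a b p s (iteratedDerivWithin j y (Icc a b)) ≤ sobolevNorm a b p (s + j) y := by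
  rw [sobolevNorm_add_order]
  exact le_add_of_nonneg_left (Finset.sum_nonneg fun _ _ => ENNReal.toReal_nonneg)

theorem sobolevNorm_iteratedDerivWithin_le_of_lt {j r : ℕ} (hj : j < r) :
    sobolevNorm a b p (s + 1) (iteratedDerivWithin j y (Icc a b)) ≤
      sobolevNorm a b p (s + r) y := by
  have e : s + r = s + 1 + j + (r - 1 - j) := by omega
  rw [e]
  exact (sobolevNorm_iteratedDerivWithin_le j).trans (sobolevNorm_mono _)

theorem sobolevNorm_derivWithin_le :
    sobolevNorm a b p s (derivWithin y (Icc a b)) ≤ sobolevNorm a b p (s + 1) y := by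
  rw [sobolevNorm_succ]
  exact le_add_of_nonneg_left ENNReal.toReal_nonneg

theorem eLpNorm_toReal_le_sobolevNorm :
    (eLpNorm y p (intervalMeasure a b)).toReal ≤ sobolevNorm a b p s y := by
  rw [← sobolevNorm_zero]
  simpa using sobolevNorm_mono (s := 0) s

theorem sobolevNorm_congr (h : EqOn y z (Icc a b)) :
    sobolevNorm a b p s y = sobolevNorm a b p s z := by
  refine Finset.sum_congr rfl fun k _ => ?_
  congr 1
  refine eLpNorm_congr_ae ?_
  filter_upwards [ae_restrict_mem measurableSet_Icc] with t ht
  exact iteratedDerivWithin_congr h ht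

theorem sobolevNorm_const_smul (c : ℂ) :
    sobolevNorm a b p s (c • y) = ‖c‖ * sobolevNorm a b p s y := by
  rw [sobolevNorm, sobolevNorm, Finset.mul_sum]
  refine Finset.sum_congr rfl fun k _ => ?_
  have e : iteratedDerivWithin k (c • y) (Icc a b) = c • iteratedDerivWithin k y (Icc a b) := by
    funext t
    exact iteratedDerivWithin_const_smul_field c _
  rw [e, eLpNorm_const_smul, ENNReal.toReal_mul]
  simp

theorem sobolevNorm_neg : sobolevNorm a b p s (-y) = sobolevNorm a b p s y := by
  simpa using sobolevNorm_const_smul (a := a) (b := b) (p := p) (s := s) (y := y) (-1)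

theorem sobolevNorm_zero_fun : sobolevNorm a b p s 0 = 0 := by
  simpa using sobolevNorm_const_smul (a := a) (b := b) (p := p) (s := s) (y := 0) 0

theorem IsSobolev.neg (hy : IsSobolev a b p s y) : IsSobolev a b p s (-y) := by
  simpa using hy.const_smul (-1)

variable [hab : Fact (a < b)]

theorem IsSobolev.sub (hy : IsSobolev a b p s y) (hz : IsSobolev a b p s z) :
    IsSobolev a b p s (y - z) := by
  simpa [sub_eq_add_neg] using hy.add hab.out hz.neg

theorem sobolevNorm_congr_ae (hy : IsSobolev a b p s y) (hz : IsSobolev a b p s z)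
    (h : y =ᵐ[intervalMeasure a b] z) : sobolevNorm a b p s y = sobolevNorm a b p s z := by
  cases s with
  | zero => rw [sobolevNorm_zero, sobolevNorm_zero, eLpNorm_congr_ae h]
  | succ s =>
    refine sobolevNorm_congr ?_
    exact Measure.eqOn_Icc_of_ae_eq volume hab.out.ne h hy.continuousOn hz.continuousOn

/-- Differentiation is additive up to functions of norm zero. -/
theorem sobolevNorm_derivWithin_sub (hy : IsSobolev a b p (s + 1) y)
    (hz : IsSobolev a b p (s + 1) z) :
    sobolevNorm a b p s (derivWithin (y - z) (Icc a b)) =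
      sobolevNorm a b p s (derivWithin y (Icc a b) - derivWithin z (Icc a b)) := by
  have h1 : ∀ {w : ℝ → ℂ}, IsSobolev a b p (s + 1) w → IsSobolev a b p 1 w := fun hw =>
    IsSobolev.mono_add hab.out s (by rwa [add_comm] at hw)
  refine sobolevNorm_congr_ae ((hy.sub hz).derivWithin hab.out)
    ((hy.derivWithin hab.out).sub (hz.derivWithin hab.out)) ?_
  filter_upwards [(h1 hy).ae_differentiableWithinAt, (h1 hz).ae_differentiableWithinAt] with t h2 h3
  exact derivWithin_sub h2 h3

variable [hp : Fact (1 ≤ p)]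

theorem sobolevNorm_add_le (hy : IsSobolev a b p s y) (hz : IsSobolev a b p s z) :
    sobolevNorm a b p s (y + z) ≤ sobolevNorm a b p s y + sobolevNorm a b p s z :=
  SobolevSpace.norm_add_le' (⟨y, hy⟩ : SobolevSpace a b p s) ⟨z, hz⟩

theorem sobolevNorm_sub_le (hy : IsSobolev a b p s y) (hz : IsSobolev a b p s z) :
    sobolevNorm a b p s (y - z) ≤ sobolevNorm a b p s y + sobolevNorm a b p s z := by
  rw [sub_eq_add_neg, ← sobolevNorm_neg (y := z)]
  exact sobolevNorm_add_le hy hz.neg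

theorem sobolevNorm_sum_le {ι : Type*} (S : Finset ι) {u : ι → ℝ → ℂ}
    (hu : ∀ i, IsSobolev a b p s (u i)) :
    sobolevNorm a b p s (∑ i ∈ S, u i) ≤ ∑ i ∈ S, sobolevNorm a b p s (u i) := by
  classical
  induction S using Finset.induction_on with
  | empty => simp [sobolevNorm_zero_fun]
  | insert i S hi ih =>
    rw [Finset.sum_insert hi, Finset.sum_insert hi]
    exact (sobolevNorm_add_le (hu i) (IsSobolev.sum hab.out S hu)).trans
      (add_le_add le_rfl ih)

/-- On functions of class `W_p^s` the norm vanishes exactly on the functions that vanish almost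
everywhere. -/
theorem sobolevNorm_eq_zero_iff (hy : IsSobolev a b p s y) :
    sobolevNorm a b p s y = 0 ↔ y =ᵐ[intervalMeasure a b] 0 := by
  constructor
  · intro h
    have h0 : (eLpNorm y p (intervalMeasure a b)).toReal = 0 :=
      le_antisymm (h ▸ eLpNorm_toReal_le_sobolevNorm) ENNReal.toReal_nonneg
    have hm := hy.memLp hab.out
    rw [ENNReal.toReal_eq_zero_iff] at h0
    exact (eLpNorm_eq_zero_iff hm.1 (zero_lt_one.trans_le hp.out).ne').1
      (h0.resolve_right hm.2.ne)
  · intro h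
    rw [sobolevNorm_congr_ae hy IsSobolev.zero h]
    exact sobolevNorm_zero_fun

end Norm

/-! ### Calculus and multiplication in Sobolev spaces -/

section Calculus

variable {a b : ℝ} {p : ℝ≥0∞} {s : ℕ} {y z g : ℝ → ℂ}

theorem integrableOn_of_memLp (hp : 1 ≤ p) (hg : MemLp g p (intervalMeasure a b)) :
    IntegrableOn g (Icc a b) :=
  hg.integrable hp

theorem intervalIntegrable_of_memLp (hp : 1 ≤ p) (hg : MemLp g p (intervalMeasure a b))
    {x t : ℝ} (hx : x ∈ Icc a b) (ht : t ∈ Icc a b) : IntervalIntegrable g volume x t :=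
  ((integrableOn_of_memLp hp hg).mono_set (uIcc_subset_Icc hx ht)).intervalIntegrable

/-- The indefinite integral of an integrable function is absolutely continuous: its increments are
dominated by those of the indefinite integral of the norm. -/
theorem absolutelyContinuousOnInterval_integral
    (hg : IntervalIntegrable g volume a b) :
    AbsolutelyContinuousOnInterval (fun t => ∫ x in a..t, g x) a b := by
  have h := hg.norm.absolutelyContinuousOnInterval_intervalIntegral left_mem_uIcc
  rw [absolutelyContinuousOnInterval_iff] at h ⊢
  intro ε hε
  obtain ⟨δ, hδ, H⟩ := h ε hε
  refine ⟨δ, hδ, fun E hE hs => (Finset.sum_le_sum fun i hi => ?_).trans_lt (H E hE hs)⟩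
  have hi := hE.1 i hi
  have h1 : ∀ {x}, x ∈ uIcc a b → IntervalIntegrable g volume a x := fun hx =>
    hg.mono_set (uIcc_subset_uIcc left_mem_uIcc hx)
  rw [dist_eq_norm, dist_eq_norm, intervalIntegral.integral_interval_sub_left (h1 hi.1) (h1 hi.2),
    intervalIntegral.integral_interval_sub_left (h1 hi.1).norm (h1 hi.2).norm, Real.norm_eq_abs]
  exact intervalIntegral.norm_integral_le_abs_integral_norm

/-- The fundamental theorem of calculus in `W_p^1`. -/
theorem IsSobolev.sub_eq_integral (hab : a < b) (hp : 1 ≤ p) (hy : IsSobolev a b p 1 y)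
    {x t : ℝ} (hx : x ∈ Icc a b) (ht : t ∈ Icc a b) :
    y t - y x = ∫ τ in x..t, _root_.derivWithin y (Icc a b) τ := by
  have hy' := IsSobolev.one_iff.1 hy
  have hI := fun {x t : ℝ} (hx : x ∈ Icc a b) (ht : t ∈ Icc a b) =>
    intervalIntegrable_of_memLp hp hy'.2 hx ht
  have ha : a ∈ Icc a b := left_mem_Icc.2 hab.le
  have hb : b ∈ Icc a b := right_mem_Icc.2 hab.le
  have hG := absolutelyContinuousOnInterval_integral (hI ha hb)
  obtain ⟨C, hC⟩ := (hy'.1.sub hG).const_of_ae_hasDerivAt_zero (by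
    have hae := ae_differentiableWithinAt hy
    rw [ae_restrict_iff' measurableSet_Icc] at hae
    -- The one-sided derivative is a two-sided one away from the end points.
    filter_upwards [hae, (hI ha hb).ae_hasDerivAt_integral, Measure.ae_ne volume a,
      Measure.ae_ne volume b] with t h1 h2 h3 h4 ht
    have ht' : t ∈ Icc a b := by rwa [uIcc_of_le hab.le] at ht
    have hn : Icc a b ∈ 𝓝 t := Icc_mem_nhds (lt_of_le_of_ne ht'.1 h3.symm)
      (lt_of_le_of_ne ht'.2 h4)
    have h5 := ((h1 ht').hasDerivWithinAt.hasDerivAt hn).sub (h2 ht a left_mem_uIcc)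
    simpa using h5)
  rw [uIcc_of_le hab.le] at hC
  have e1 := hC t ht
  have e2 := hC x hx
  simp only [Pi.sub_apply] at e1 e2
  rw [← intervalIntegral.integral_interval_sub_left (hI ha ht) (hI ha hx)]
  linear_combination e1 - e2

/-- On a finite interval the `L_p` norm controls the `L_1` norm. -/
theorem exists_integral_norm_le (hab : a ≤ b) (hp : 1 ≤ p) : ∃ K : ℝ, 0 ≤ K ∧ ∀ g : ℝ → ℂ,
    MemLp g p (intervalMeasure a b) →
      ∫ t in a..b, ‖g t‖ ≤ K * (eLpNorm g p (intervalMeasure a b)).toReal := by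
  refine ⟨((intervalMeasure a b univ) ^ (1 / (1 : ℝ≥0∞).toReal - 1 / p.toReal)).toReal,
    ENNReal.toReal_nonneg, fun g hg => ?_⟩
  have h := eLpNorm_le_eLpNorm_mul_rpow_measure_univ hp hg.1
  have hfin : (intervalMeasure a b univ) ^ (1 / (1 : ℝ≥0∞).toReal - 1 / p.toReal) ≠ ∞ := by
    refine ENNReal.rpow_ne_top_of_nonneg ?_ (measure_ne_top _ _)
    rw [sub_nonneg]
    rcases eq_or_ne p ∞ with rfl | hpt
    · simp
    · have : 1 ≤ p.toReal := by simpa using ENNReal.toReal_mono hpt hp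
      simpa using inv_le_one_of_one_le₀ this
  have h' := ENNReal.toReal_mono (ENNReal.mul_ne_top hg.2.ne hfin) h
  rw [ENNReal.toReal_mul, mul_comm] at h'
  refine le_trans (le_of_eq ?_) h'
  rw [eLpNorm_one_eq_lintegral_enorm, ← integral_norm_eq_lintegral_enorm hg.1,
    intervalIntegral.integral_of_le hab, ← integral_Icc_eq_integral_Ioc]

theorem norm_integral_le_integral_norm_Icc (hab : a ≤ b) (hg : IntegrableOn g (Icc a b))
    {x t : ℝ} (hx : x ∈ Icc a b) (ht : t ∈ Icc a b) :
    ‖∫ τ in x..t, g τ‖ ≤ ∫ τ in a..b, ‖g τ‖ := by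
  rw [intervalIntegral.integral_of_le hab, ← integral_Icc_eq_integral_Ioc]
  refine intervalIntegral.norm_integral_le_integral_norm_uIoc.trans ?_
  refine setIntegral_mono_set hg.norm (Eventually.of_forall fun _ => norm_nonneg _) ?_
  exact (uIoc_subset_uIcc.trans (uIcc_subset_Icc hx ht)).eventuallyLE

/-- A function of class `W_p^1` is bounded by its value at one point and the `L_p` norm of its
derivative. -/
theorem exists_norm_le_norm_add (hab : a < b) (hp : 1 ≤ p) : ∃ K : ℝ, 0 ≤ K ∧ ∀ y : ℝ → ℂ,
    IsSobolev a b p 1 y → ∀ x ∈ Icc a b, ∀ t ∈ Icc a b,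
      ‖y t‖ ≤ ‖y x‖ +
        K * (eLpNorm (derivWithin y (Icc a b)) p (intervalMeasure a b)).toReal := by
  obtain ⟨K, hK, H⟩ := exists_integral_norm_le hab.le hp
  refine ⟨K, hK, fun y hy x hx t ht => ?_⟩
  have hy' := IsSobolev.one_iff.1 hy
  have h1 := norm_integral_le_integral_norm_Icc hab.le (integrableOn_of_memLp hp hy'.2) hx ht
  rw [← hy.sub_eq_integral hab hp hx ht] at h1
  have h2 := H _ hy'.2
  have h3 := norm_add_le (y x) (y t - y x)
  rw [add_sub_cancel] at h3
  linarith

/-- The embedding of `W_p^1` into the continuous functions. -/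
theorem exists_norm_le_sobolevNorm (hab : a < b) (hp : 1 ≤ p) : ∃ K : ℝ, 0 ≤ K ∧ ∀ y : ℝ → ℂ,
    IsSobolev a b p 1 y → ∀ t ∈ Icc a b, ‖y t‖ ≤ K * sobolevNorm a b p 1 y := by
  obtain ⟨K, hK, H⟩ := exists_integral_norm_le hab.le hp
  obtain ⟨K', hK', H'⟩ := exists_norm_le_norm_add hab hp
  have hba : 0 < b - a := sub_pos.2 hab
  refine ⟨K / (b - a) + K', by positivity, fun y hy t ht => ?_⟩
  -- The pointwise bound is averaged over the base point.
  have h1 : ∫ _ in a..b, ‖y t‖ ≤ ∫ x in a..b, (‖y x‖ +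
      K' * (eLpNorm (derivWithin y (Icc a b)) p (intervalMeasure a b)).toReal) := by
    refine intervalIntegral.integral_mono_on hab.le (by simp) ?_ fun x hx => H' y hy x hx t ht
    refine IntervalIntegrable.add ?_ (by simp)
    exact (intervalIntegrable_of_memLp hp (hy.memLp hab) (left_mem_Icc.2 hab.le)
      (right_mem_Icc.2 hab.le)).norm
  rw [intervalIntegral.integral_add (intervalIntegrable_of_memLp hp (hy.memLp hab)
    (left_mem_Icc.2 hab.le) (right_mem_Icc.2 hab.le)).norm (by simp)] at h1
  simp only [intervalIntegral.integral_const, smul_eq_mul] at h1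
  have h2 := H y (hy.memLp hab)
  rw [sobolevNorm_succ, sobolevNorm_zero]
  set P := (eLpNorm y p (intervalMeasure a b)).toReal
  set Q := (eLpNorm (derivWithin y (Icc a b)) p (intervalMeasure a b)).toReal
  have hP : 0 ≤ P := ENNReal.toReal_nonneg
  have hQ : 0 ≤ Q := ENNReal.toReal_nonneg
  have h3 : ‖y t‖ ≤ K / (b - a) * P + K' * Q := by
    rw [← mul_le_mul_iff_right₀ hba]
    have : (b - a) * (K / (b - a) * P + K' * Q) = K * P + (b - a) * (K' * Q) := by
      field_simp
    linarith
  nlinarith [mul_nonneg hK' hP, mul_nonneg (div_nonneg hK hba.le) hQ]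

/-- A bounded factor in an `L_p` estimate. -/
theorem eLpNorm_mul_toReal_le {M : ℝ} (hM : 0 ≤ M) (hy : MemLp y p (intervalMeasure a b))
    (hz : ∀ t ∈ Icc a b, ‖z t‖ ≤ M) :
    (eLpNorm (y * z) p (intervalMeasure a b)).toReal ≤
      M * (eLpNorm y p (intervalMeasure a b)).toReal := by
  have h : eLpNorm (y * z) p (intervalMeasure a b) ≤
      ENNReal.ofReal M * eLpNorm y p (intervalMeasure a b) := by
    refine eLpNorm_le_mul_eLpNorm_of_ae_le_mul ?_ p
    filter_upwards [ae_restrict_mem measurableSet_Icc] with t ht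
    rw [Pi.mul_apply, norm_mul, mul_comm]
    exact mul_le_mul_of_nonneg_right (hz t ht) (norm_nonneg _)
  have h' := ENNReal.toReal_mono (ENNReal.mul_ne_top ENNReal.ofReal_ne_top hy.2.ne) h
  rwa [ENNReal.toReal_mul, ENNReal.toReal_ofReal hM] at h'

/-- On a finite interval the supremum norm controls the `L_p` norm. -/
theorem exists_eLpNorm_toReal_le : ∃ K : ℝ, 0 ≤ K ∧ ∀ (M : ℝ) (g : ℝ → ℂ), 0 ≤ M →
    (∀ t ∈ Icc a b, ‖g t‖ ≤ M) → (eLpNorm g p (intervalMeasure a b)).toReal ≤ K * M := by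
  have h1 : MemLp (1 : ℝ → ℂ) p (intervalMeasure a b) := memLp_const 1
  refine ⟨(eLpNorm (1 : ℝ → ℂ) p (intervalMeasure a b)).toReal, ENNReal.toReal_nonneg,
    fun M g hM hg => ?_⟩
  simpa [mul_comm] using eLpNorm_mul_toReal_le hM h1 hg

theorem IsSobolev.one_of_succ (hab : a < b) (hy : IsSobolev a b p (s + 1) y) :
    IsSobolev a b p 1 y :=
  IsSobolev.mono_add hab s (by rwa [add_comm] at hy)

theorem exists_eLpNorm_mul_toReal_le (hab : a < b) (hp : 1 ≤ p) : ∃ K : ℝ, 0 ≤ K ∧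
    ∀ (s : ℕ) (y z : ℝ → ℂ), IsSobolev a b p s y → IsSobolev a b p 1 z →
      (eLpNorm (y * z) p (intervalMeasure a b)).toReal ≤
        K * (sobolevNorm a b p s y * sobolevNorm a b p 1 z) := by
  obtain ⟨K, hK, H⟩ := exists_norm_le_sobolevNorm hab hp
  refine ⟨K, hK, fun s y z hy hz => ?_⟩
  refine (eLpNorm_mul_toReal_le (mul_nonneg hK sobolevNorm_nonneg) (hy.memLp hab)
    (H z hz)).trans ?_
  rw [mul_assoc, mul_comm (sobolevNorm a b p s y)]
  exact mul_le_mul_of_nonneg_left (mul_le_mul_of_nonneg_left eLpNorm_toReal_le_sobolevNorm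
    sobolevNorm_nonneg) hK

/-- The Leibniz rule turns a bound for multiplication `W_p^s × W_p^{s+1} → W_p^s` into the algebra
bound in `W_p^{s+1}`. -/
theorem exists_sobolevNorm_mul_le_step [hab : Fact (a < b)] [hp : Fact (1 ≤ p)] {s : ℕ} {K : ℝ}
    (hK : 0 ≤ K) (H : ∀ y z : ℝ → ℂ, IsSobolev a b p s y → IsSobolev a b p (s + 1) z →
      sobolevNorm a b p s (y * z) ≤
        K * (sobolevNorm a b p s y * sobolevNorm a b p (s + 1) z)) :
    ∃ K : ℝ, 0 ≤ K ∧ ∀ y z : ℝ → ℂ, IsSobolev a b p (s + 1) y → IsSobolev a b p (s + 2) z →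
      sobolevNorm a b p (s + 1) (y * z) ≤
        K * (sobolevNorm a b p (s + 1) y * sobolevNorm a b p (s + 1) z) := by
  obtain ⟨K₀, hK₀, base⟩ := exists_eLpNorm_mul_toReal_le (p := p) hab.out hp.out
  refine ⟨K₀ + 2 * K, by positivity, fun y z hy hz => ?_⟩
  have hy' := hy.derivWithin hab.out
  have hz' := hz.derivWithin hab.out
  have hz1 := hz.mono_succ hab.out
  have hd : derivWithin (y * z) (Icc a b) =ᵐ[intervalMeasure a b]
      derivWithin y (Icc a b) * z + derivWithin z (Icc a b) * y := by
    filter_upwards [(hy.one_of_succ hab.out).ae_differentiableWithinAt,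
      (hz.one_of_succ hab.out).ae_differentiableWithinAt] with t h1 h2
    rw [derivWithin_mul h1 h2]
    simp [mul_comm]
  have i1 := hy'.mul hab.out hz1
  have i2 := (hz'.mono_succ hab.out).mul hab.out hy
  rw [sobolevNorm_succ, sobolevNorm_congr_ae ((hy.mul hab.out hz).derivWithin hab.out)
    (i1.add hab.out i2) hd]
  have h1 := base _ y z hy (hz.one_of_succ hab.out)
  have h2 := sobolevNorm_add_le i1 i2
  have h3 := H _ _ hy' hz1
  have h4 := H _ _ (hz'.mono_succ hab.out) hy
  have n0 : sobolevNorm a b p (s + 1) y * sobolevNorm a b p 1 z ≤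
      sobolevNorm a b p (s + 1) y * sobolevNorm a b p (s + 1) z := by
    exact mul_le_mul_of_nonneg_left sobolevNorm_one_le sobolevNorm_nonneg
  have n1 : sobolevNorm a b p s (derivWithin y (Icc a b)) * sobolevNorm a b p (s + 1) z ≤
      sobolevNorm a b p (s + 1) y * sobolevNorm a b p (s + 1) z :=
    mul_le_mul_of_nonneg_right sobolevNorm_derivWithin_le sobolevNorm_nonneg
  have n2 : sobolevNorm a b p s (derivWithin z (Icc a b)) * sobolevNorm a b p (s + 1) y ≤
      sobolevNorm a b p (s + 1) y * sobolevNorm a b p (s + 1) z := by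
    rw [mul_comm]
    exact mul_le_mul_of_nonneg_left sobolevNorm_derivWithin_le sobolevNorm_nonneg
  linarith [mul_le_mul_of_nonneg_left n0 hK₀, mul_le_mul_of_nonneg_left n1 hK,
    mul_le_mul_of_nonneg_left n2 hK]

/-- The product of an element of `W_p^s` and an element of `W_p^{s+1}`, as a bounded bilinear
operation with values in `W_p^s`. -/
theorem exists_sobolevNorm_mul_le [hab : Fact (a < b)] [hp : Fact (1 ≤ p)] (s : ℕ) :
    ∃ K : ℝ, 0 ≤ K ∧ ∀ y z : ℝ → ℂ, IsSobolev a b p s y → IsSobolev a b p (s + 1) z →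
      sobolevNorm a b p s (y * z) ≤
        K * (sobolevNorm a b p s y * sobolevNorm a b p (s + 1) z) := by
  induction s with
  | zero =>
    obtain ⟨K, hK, H⟩ := exists_eLpNorm_mul_toReal_le (p := p) hab.out hp.out
    exact ⟨K, hK, fun y z hy hz => by rw [sobolevNorm_zero]; exact H 0 y z hy hz⟩
  | succ s ih =>
    obtain ⟨K, hK, H⟩ := ih
    obtain ⟨K', hK', H'⟩ := exists_sobolevNorm_mul_le_step hK H
    exact ⟨K', hK', fun y z hy hz => (H' y z hy hz).trans (mul_le_mul_of_nonneg_left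
      (mul_le_mul_of_nonneg_left (sobolevNorm_mono 1) sobolevNorm_nonneg) hK')⟩

/-- For `s ≥ 1` the multiplication is bounded in the norm of `W_p^s` itself. The extra regularity
of `z` is only a convenience: it makes `IsSobolev.mul` applicable. -/
theorem exists_sobolevNorm_succ_mul_le [hab : Fact (a < b)] [hp : Fact (1 ≤ p)] (s : ℕ) :
    ∃ K : ℝ, 0 ≤ K ∧ ∀ y z : ℝ → ℂ, IsSobolev a b p (s + 1) y → IsSobolev a b p (s + 2) z →
      sobolevNorm a b p (s + 1) (y * z) ≤
        K * (sobolevNorm a b p (s + 1) y * sobolevNorm a b p (s + 1) z) := by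
  obtain ⟨K, hK, H⟩ := exists_sobolevNorm_mul_le (a := a) (b := b) (p := p) s
  exact exists_sobolevNorm_mul_le_step hK H

end Calculus

/-! ### Primitives and completeness -/

section Complete

variable {a b : ℝ} [hab : Fact (a < b)] {p : ℝ≥0∞} {s : ℕ} {g : ℝ → ℂ}

namespace SobolevSpace

/-- The element of `W_p^s` given by a function of class `W_p^s`. -/
def of {y : ℝ → ℂ} (hy : IsSobolev a b p s y) : SobolevSpace a b p s := ⟨y, hy⟩

theorem isSobolev (y : SobolevSpace a b p s) : IsSobolev a b p s y := y.2

theorem norm_eq_sobolevNorm (y : SobolevSpace a b p s) : ‖y‖ = sobolevNorm a b p s y := rfl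

end SobolevSpace

variable [hp : Fact (1 ≤ p)]

/-- Primitives of functions of class `W_p^s` are of class `W_p^{s+1}`. -/
theorem IsSobolev.primitive (hg : IsSobolev a b p s g) (c : ℂ) :
    IsSobolev a b p (s + 1) (fun t => c + ∫ x in a..t, g x) ∧
      _root_.derivWithin (fun t => c + ∫ x in a..t, g x) (Icc a b) =ᵐ[intervalMeasure a b] g := by
  have ha : a ∈ Icc a b := left_mem_Icc.2 hab.out.le
  have hb : b ∈ Icc a b := right_mem_Icc.2 hab.out.le
  have hI : ∀ {t}, t ∈ Icc a b → IntervalIntegrable g volume a t := fun ht =>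
    intervalIntegrable_of_memLp hp.out (hg.memLp hab.out) ha ht
  cases s with
  | zero =>
    have hd : _root_.derivWithin (fun t => c + ∫ x in a..t, g x) (Icc a b)
        =ᵐ[intervalMeasure a b] g := by
      rw [EventuallyEq, ae_restrict_iff' measurableSet_Icc]
      filter_upwards [(hI hb).ae_hasDerivAt_integral] with t h1 ht
      have h2 := h1 (by rwa [uIcc_of_le hab.out.le]) a left_mem_uIcc
      exact ((h2.const_add c).hasDerivWithinAt).derivWithin (uniqueDiffOn_Icc hab.out t ht)
    refine ⟨IsSobolev.one_iff.2 ⟨?_, MemLp.ae_eq hd.symm hg⟩, hd⟩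
    have hc : AbsolutelyContinuousOnInterval (fun _ => c) a b :=
      contDiffOn_const.absolutelyContinuousOnInterval
    exact hc.add (absolutelyContinuousOnInterval_integral (hI hb))
  | succ s =>
    have hc := hg.continuousOn
    have hd : ∀ t ∈ Icc a b,
        HasDerivWithinAt (fun t => c + ∫ x in a..t, g x) (g t) (Icc a b) t := by
      intro t ht
      have : Fact (t ∈ Icc a b) := ⟨ht⟩
      refine HasDerivWithinAt.const_add c ?_
      exact intervalIntegral.integral_hasDerivWithinAt_right (hI ht)
        (hc.stronglyMeasurableAtFilter_nhdsWithin measurableSet_Icc t) (hc t ht)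
    have he : EqOn (_root_.derivWithin (fun t => c + ∫ x in a..t, g x) (Icc a b)) g (Icc a b) :=
      fun t ht => (hd t ht).derivWithin (uniqueDiffOn_Icc hab.out t ht)
    refine ⟨(IsSobolev.succ_succ_iff hab.out).2
      ⟨fun t ht => (hd t ht).differentiableWithinAt, hg.congr hab.out he⟩, ?_⟩
    filter_upwards [ae_restrict_mem measurableSet_Icc] with t ht using he ht

/-- The norm of `W_p^{s+1}` is controlled by the value at the left end and the norm of the
derivative in `W_p^s`. -/
theorem exists_sobolevNorm_succ_le (s : ℕ) : ∃ K : ℝ, 0 ≤ K ∧ ∀ y : ℝ → ℂ,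
    IsSobolev a b p (s + 1) y → sobolevNorm a b p (s + 1) y ≤
      K * (‖y a‖ + sobolevNorm a b p s (derivWithin y (Icc a b))) := by
  obtain ⟨K, hK, H⟩ := exists_norm_le_norm_add (p := p) hab.out hp.out
  obtain ⟨K', hK', H'⟩ := exists_eLpNorm_toReal_le (a := a) (b := b) (p := p)
  refine ⟨K' + K' * K + 1, by positivity, fun y hy => ?_⟩
  have h1 := H' _ y (add_nonneg (norm_nonneg _) (mul_nonneg hK ENNReal.toReal_nonneg))
    (H y (hy.one_of_succ hab.out) a (left_mem_Icc.2 hab.out.le))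
  have h2 : (eLpNorm (derivWithin y (Icc a b)) p (intervalMeasure a b)).toReal ≤
    sobolevNorm a b p s (derivWithin y (Icc a b)) := eLpNorm_toReal_le_sobolevNorm
  have h3 := norm_nonneg (y a)
  have h4 : 0 ≤ sobolevNorm a b p s (derivWithin y (Icc a b)) := sobolevNorm_nonneg
  rw [sobolevNorm_succ]
  nlinarith [mul_le_mul_of_nonneg_left h2 (mul_nonneg hK' hK), mul_nonneg hK' h3,
    mul_nonneg hK' h4, mul_nonneg (mul_nonneg hK' hK) h3]

namespace SobolevSpace

theorem dist_def (y z : SobolevSpace a b p s) :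
    dist y z = sobolevNorm a b p s ((y : ℝ → ℂ) - z) := dist_eq_norm y z

theorem lipschitzWith_apply_left : ∃ K, LipschitzWith K
    (fun y : SobolevSpace a b p (s + 1) => y a) := by
  obtain ⟨K, hK, H⟩ := exists_norm_le_sobolevNorm (p := p) hab.out hp.out
  refine ⟨⟨K, hK⟩, LipschitzWith.of_dist_le_mul fun y z => ?_⟩
  rw [dist_def, dist_eq_norm]
  refine (H _ ((y.isSobolev.sub z.isSobolev).one_of_succ hab.out) a
    (left_mem_Icc.2 hab.out.le)).trans ?_
  exact mul_le_mul_of_nonneg_left sobolevNorm_one_le hK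

theorem lipschitzWith_derivWithin : LipschitzWith 1
    (fun y : SobolevSpace a b p (s + 1) =>
      of (y.isSobolev.derivWithin hab.out)) := by
  refine LipschitzWith.of_dist_le_mul fun y z => ?_
  rw [dist_def, dist_def, NNReal.coe_one, one_mul]
  exact (sobolevNorm_derivWithin_sub y.isSobolev z.isSobolev).symm.trans_le
    sobolevNorm_derivWithin_le

theorem completeSpace_zero : CompleteSpace (SobolevSpace a b p 0) := by
  let f : SobolevSpace a b p 0 → Lp ℂ p (intervalMeasure a b) := fun y => MemLp.toLp y y.isSobolev
  have hf : Isometry f := by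
    refine Isometry.of_dist_eq fun y z => ?_
    rw [dist_def, dist_eq_norm, sobolevNorm_zero, ← Lp.norm_toLp _ (y.isSobolev.sub z.isSobolev)]
    rfl
  refine (hf.isUniformInducing.completeSpace_congr fun g => ?_).2 inferInstance
  exact ⟨of (s := 0) (Lp.memLp g), Lp.toLp_coeFn g _⟩

/-- `W_p^{s+1}` inherits completeness from `ℂ × W_p^s` through `y ↦ (y(a), y')`, the limit being
reconstructed by integration. -/
instance completeSpace : CompleteSpace (SobolevSpace a b p s) := by
  induction s with
  | zero => exact completeSpace_zero
  | succ s ih =>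
    refine Metric.complete_of_cauchySeq_tendsto fun u hu => ?_
    obtain ⟨K, hK⟩ := lipschitzWith_apply_left (a := a) (b := b) (p := p) (s := s)
    obtain ⟨c, hc⟩ := cauchySeq_tendsto_of_complete (hK.uniformContinuous.comp_cauchySeq hu)
    obtain ⟨g, hg⟩ := cauchySeq_tendsto_of_complete
      ((lipschitzWith_derivWithin (a := a) (b := b) (p := p)
        (s := s)).uniformContinuous.comp_cauchySeq hu)
    obtain ⟨hy, hd⟩ := IsSobolev.primitive g.isSobolev c
    refine ⟨of hy, ?_⟩
    obtain ⟨K', -, H⟩ := exists_sobolevNorm_succ_le (a := a) (b := b) (p := p) s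
    rw [tendsto_iff_dist_tendsto_zero] at hc hg ⊢
    refine squeeze_zero (fun _ => dist_nonneg) (fun k => ?_)
      (by simpa using (hc.add hg).const_mul K')
    rw [dist_def]
    refine (H _ ((u k).isSobolev.sub hy)).trans (le_of_eq ?_)
    rw [sobolevNorm_derivWithin_sub (u k).isSobolev hy, dist_eq_norm, dist_def]
    congr 2
    · simp
    · exact sobolevNorm_congr_ae
        (((u k).isSobolev.derivWithin hab.out).sub (hy.derivWithin hab.out))
        (((u k).isSobolev.derivWithin hab.out).sub g.isSobolev) ((ae_eq_refl _).sub hd)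

end SobolevSpace

end Complete

/-! ### The a priori estimate -/

section APriori

variable {a b : ℝ} {p : ℝ≥0∞} {n m r : ℕ}

/-- The expression `∑_j A_j y^{(j)}` of order less than `r`; the difference of two differential
expressions of order `r` with leading coefficient one is of this form. -/
noncomputable def lowerOrderExpr (a b : ℝ) (A : Fin r → Fin m → Fin m → ℝ → ℂ)
    (y : Fin m → ℝ → ℂ) (i : Fin m) : ℝ → ℂ :=
  ∑ j : Fin r, ∑ i' : Fin m, A j i i' * iteratedDerivWithin j (y i') (Icc a b)

/-- The differential expression `y^{(r)} + ∑_j A_j y^{(j)}` for plain functions; `diffOp` is its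
bundled form. -/
noncomputable def diffExpr (a b : ℝ) (A : Fin r → Fin m → Fin m → ℝ → ℂ) (y : Fin m → ℝ → ℂ)
    (i : Fin m) : ℝ → ℂ :=
  iteratedDerivWithin r (y i) (Icc a b) + lowerOrderExpr a b A y i

theorem diffExpr_sub (A A' : Fin r → Fin m → Fin m → ℝ → ℂ) (y : Fin m → ℝ → ℂ) (i : Fin m) :
    diffExpr a b A y i - diffExpr a b A' y i = lowerOrderExpr a b (A - A') y i := by
  simp only [diffExpr, lowerOrderExpr, add_sub_add_left_eq_sub, ← Finset.sum_sub_distrib,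
    Pi.sub_apply, sub_mul]

/-- The size of the Cauchy data of `y` of orders below `r` at the points of `T`. -/
noncomputable def dataNorm (a b : ℝ) (r : ℕ) (T : Finset ℝ) (y : Fin m → ℝ → ℂ) : ℝ :=
  ∑ x ∈ T, ∑ i : Fin m, ∑ j : Fin r, ‖iteratedDerivWithin j (y i) (Icc a b) x‖

theorem dataNorm_nonneg {T : Finset ℝ} {y : Fin m → ℝ → ℂ} : 0 ≤ dataNorm a b r T y := by
  unfold dataNorm; positivity

/-- A finite net of `[a, b]` that is fine with respect to the indefinite integral of `w`. -/
theorem exists_finset_abs_integral_le {w : ℝ → ℝ} (hab : a ≤ b) (hw : IntegrableOn w (Icc a b))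
    {ε : ℝ} (hε : 0 < ε) : ∃ T : Finset ℝ, (↑T : Set ℝ) ⊆ Icc a b ∧
      ∀ t ∈ Icc a b, ∃ x ∈ T, |∫ τ in x..t, w τ| ≤ ε := by
  have hc : ContinuousOn (fun t => ∫ τ in a..t, w τ) (Icc a b) := by
    have := intervalIntegral.continuousOn_primitive_interval (a := a) (b := b) (f := w)
      (μ := volume) (by rwa [uIcc_of_le hab])
    rwa [uIcc_of_le hab] at this
  have hu := isCompact_Icc.uniformContinuousOn_of_continuous hc
  obtain ⟨δ, hδ, H⟩ := Metric.uniformContinuousOn_iff.1 hu ε hε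
  obtain ⟨S, hS, hfin, hcov⟩ := (isCompact_Icc (a := a) (b := b)).finite_cover_balls hδ
  refine ⟨hfin.toFinset, by simpa using hS, fun t ht => ?_⟩
  obtain ⟨x, hx, hxt⟩ := mem_iUnion₂.1 (hcov ht)
  refine ⟨x, by simpa using hx, ?_⟩
  have h1 := (H t ht x (hS hx) hxt).le
  have hI : ∀ {t}, t ∈ Icc a b → IntervalIntegrable w volume a t := fun ht =>
    (hw.mono_set (uIcc_subset_Icc (left_mem_Icc.2 hab) ht)).intervalIntegrable
  rwa [Real.dist_eq, intervalIntegral.integral_interval_sub_left (hI ht) (hI (hS hx))] at h1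

variable [hab : Fact (a < b)]

theorem IsSobolev.iteratedDerivWithin_of_lt {j : ℕ} (hj : j < r) {y : ℝ → ℂ}
    (hy : IsSobolev a b p (n + r) y) :
    IsSobolev a b p (n + 1) (_root_.iteratedDerivWithin j y (Icc a b)) := by
  refine IsSobolev.iteratedDerivWithin hab.out j (IsSobolev.mono_add hab.out (r - 1 - j) ?_)
  have h : n + 1 + j + (r - 1 - j) = n + r := by omega
  rwa [h]

theorem isSobolev_lowerOrderExpr {A : Fin r → Fin m → Fin m → ℝ → ℂ}
    (hA : ∀ j i i', IsSobolev a b p n (A j i i')) {y : Fin m → ℝ → ℂ}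
    (hy : ∀ i, IsSobolev a b p (n + r) (y i)) (i : Fin m) :
    IsSobolev a b p n (lowerOrderExpr a b A y i) :=
  IsSobolev.sum hab.out _ fun j => IsSobolev.sum hab.out _ fun i' =>
    IsSobolev.mul hab.out (hA j i i') ((hy i').iteratedDerivWithin_of_lt j.2)

theorem isSobolev_diffExpr {A : Fin r → Fin m → Fin m → ℝ → ℂ}
    (hA : ∀ j i i', IsSobolev a b p n (A j i i')) {y : Fin m → ℝ → ℂ}
    (hy : ∀ i, IsSobolev a b p (n + r) (y i)) (i : Fin m) :
    IsSobolev a b p n (diffExpr a b A y i) :=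
  IsSobolev.add hab.out (IsSobolev.iteratedDerivWithin hab.out r (hy i))
    (isSobolev_lowerOrderExpr hA hy i)

variable [hp : Fact (1 ≤ p)]

/-- The derivatives of order below `r` are bounded by the right-hand side of the equation and the
Cauchy data on a finite set `T`. The set is chosen so fine that the coefficients have small
integral between any point and a suitable point of `T`; then the contribution of the lower-order
terms is absorbed, and neither Gronwall's inequality nor a fundamental matrix is needed. -/
theorem exists_norm_iteratedDerivWithin_le (A : Fin r → Fin m → Fin m → ℝ → ℂ)
    (hA : ∀ j i i', MemLp (A j i i') p (intervalMeasure a b)) :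
    ∃ T : Finset ℝ, (↑T : Set ℝ) ⊆ Icc a b ∧ ∃ C : ℝ, 0 ≤ C ∧ ∀ y : Fin m → ℝ → ℂ,
      (∀ i, IsSobolev a b p r (y i)) → ∀ (i : Fin m) (j : Fin r), ∀ t ∈ Icc a b,
        ‖iteratedDerivWithin j (y i) (Icc a b) t‖ ≤
          C * (∑ i, sobolevNorm a b p 0 (diffExpr a b A y i) + dataNorm a b r T y) := by
  obtain ⟨K, hK, HK⟩ := exists_integral_norm_le hab.out.le hp.out
  set w : ℝ → ℝ := fun τ => 1 + ∑ i, ∑ j, ∑ i', ‖A j i i' τ‖ with hw_def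
  have hw : IntegrableOn w (Icc a b) := by
    refine Integrable.add (integrable_const _) ?_
    refine integrable_finsetSum _ fun i _ => integrable_finsetSum _ fun j _ =>
      integrable_finsetSum _ fun i' _ => ?_
    exact (integrableOn_of_memLp hp.out (hA j i i')).norm
  set N : ℝ := (m : ℝ) * r with hN
  have hN0 : 0 ≤ N := by positivity
  -- `N` is the number of functions `y_i^{(j)}`; with this `ε` they contribute at most `M / 2` to
  -- the bound for the maximum `M` of the sum of their absolute values.
  set ε : ℝ := 1 / (2 * (N + 1)) with hε_def
  have hε : 0 < ε := by positivity
  have hNε : N * ε ≤ 1 / 2 := by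
    rw [hε_def, mul_one_div, div_le_div_iff₀ (by positivity) (by positivity)]
    linarith
  obtain ⟨T, hT, HT⟩ := exists_finset_abs_integral_le hab.out.le hw hε
  refine ⟨T, hT, 2 + 2 * N * K, by positivity, fun y hy i₀ j₀ t₀ ht₀ => ?_⟩
  have hyj : ∀ (i : Fin m) (j : Fin r),
      IsSobolev a b p 1 (iteratedDerivWithin j (y i) (Icc a b)) := fun i j =>
    IsSobolev.iteratedDerivWithin_of_lt (n := 0) j.2 (by simpa using hy i)
  set g : ℝ → ℝ := fun t => ∑ i : Fin m, ∑ j : Fin r, ‖iteratedDerivWithin j (y i) (Icc a b) t‖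
  have hgle : ∀ (i : Fin m) (j : Fin r) (t : ℝ),
      ‖iteratedDerivWithin j (y i) (Icc a b) t‖ ≤ g t := fun i j t =>
    (Finset.single_le_sum (f := fun j : Fin r => ‖iteratedDerivWithin j (y i) (Icc a b) t‖)
      (fun _ _ => norm_nonneg _) (Finset.mem_univ j)).trans
    (Finset.single_le_sum
      (f := fun i => ∑ j : Fin r, ‖iteratedDerivWithin j (y i) (Icc a b) t‖)
      (fun _ _ => Finset.sum_nonneg fun _ _ => norm_nonneg _) (Finset.mem_univ i))
  have hgc : ContinuousOn g (Icc a b) :=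
    continuousOn_finsetSum _ fun i _ => continuousOn_finsetSum _ fun j _ =>
      (hyj i j).continuousOn.norm
  obtain ⟨t, ht, hmax⟩ := isCompact_Icc.exists_isMaxOn ⟨a, left_mem_Icc.2 hab.out.le⟩ hgc
  set M := g t with hM
  have hM0 : 0 ≤ M := Finset.sum_nonneg fun _ _ => Finset.sum_nonneg fun _ _ => norm_nonneg _
  set F : ℝ → ℝ := fun τ => ∑ i, ‖diffExpr a b A y i τ‖ with hF
  have hf : ∀ i, MemLp (diffExpr a b A y i) p (intervalMeasure a b) := fun i =>
    isSobolev_diffExpr (n := 0) hA (by simpa using hy) i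
  have hFint : IntegrableOn F (Icc a b) :=
    integrable_finsetSum _ fun i _ => (integrableOn_of_memLp hp.out (hf i)).norm
  have hF0 : ∀ τ, 0 ≤ F τ := fun τ => Finset.sum_nonneg fun _ _ => norm_nonneg _
  have hder : ∀ (i : Fin m) (j : Fin r), ∀ τ ∈ Icc a b,
      ‖derivWithin (iteratedDerivWithin j (y i) (Icc a b)) (Icc a b) τ‖ ≤ w τ * M + F τ := by
    intro i j τ hτ
    rw [← iteratedDerivWithin_succ]
    have hs0 : 0 ≤ ∑ i, ∑ j, ∑ i', ‖A j i i' τ‖ := by positivity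
    -- Either the derivative is again one of the functions bounded by `M`, or the equation applies.
    by_cases hj : (j : ℕ) + 1 < r
    · have h1 := (hgle i ⟨j + 1, hj⟩ τ).trans (hmax hτ)
      have h2 : M ≤ w τ * M := le_mul_of_one_le_left hM0 (by simpa [hw_def] using hs0)
      exact (h1.trans h2).trans (le_add_of_nonneg_right (hF0 τ))
    · have hj' : (j : ℕ) + 1 = r := by omega
      rw [hj']
      have h1 : iteratedDerivWithin r (y i) (Icc a b) τ = diffExpr a b A y i τ -
          ∑ j : Fin r, ∑ i' : Fin m, A j i i' τ * iteratedDerivWithin j (y i') (Icc a b) τ := by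
        simp [diffExpr, lowerOrderExpr, Finset.sum_apply]
      rw [h1]
      refine (norm_sub_le _ _).trans ?_
      have h2 : ‖diffExpr a b A y i τ‖ ≤ F τ :=
        Finset.single_le_sum (f := fun i => ‖diffExpr a b A y i τ‖)
          (fun _ _ => norm_nonneg _) (Finset.mem_univ i)
      have h3 : ‖∑ j : Fin r, ∑ i' : Fin m,
          A j i i' τ * iteratedDerivWithin j (y i') (Icc a b) τ‖ ≤
          (∑ j, ∑ i', ‖A j i i' τ‖) * M := by
        refine (norm_sum_le _ _).trans ?_
        rw [Finset.sum_mul]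
        refine Finset.sum_le_sum fun j _ => (norm_sum_le _ _).trans ?_
        rw [Finset.sum_mul]
        refine Finset.sum_le_sum fun i' _ => ?_
        rw [norm_mul]
        exact mul_le_mul_of_nonneg_left ((hgle i' j τ).trans (hmax hτ)) (norm_nonneg _)
      have h4 : ∑ j, ∑ i', ‖A j i i' τ‖ ≤ w τ := by
        refine (Finset.single_le_sum (f := fun i => ∑ j, ∑ i', ‖A j i i' τ‖)
          (fun _ _ => by positivity) (Finset.mem_univ i)).trans ?_
        simp [hw_def]
      linarith [mul_le_mul_of_nonneg_right h4 hM0]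
  obtain ⟨x, hxT, hx⟩ := HT t ht
  have hxI : x ∈ Icc a b := hT hxT
  have hsub : uIcc x t ⊆ Icc a b := uIcc_subset_Icc hxI ht
  have hinc : ∀ (i : Fin m) (j : Fin r), ‖iteratedDerivWithin j (y i) (Icc a b) t‖ ≤
      ‖iteratedDerivWithin j (y i) (Icc a b) x‖ + (ε * M + ∫ τ in a..b, F τ) := by
    intro i j
    have hwi := (hw.mono_set hsub).intervalIntegrable
    have hFi := (hFint.mono_set hsub).intervalIntegrable
    have h1 : ‖∫ τ in x..t, derivWithin (iteratedDerivWithin j (y i) (Icc a b)) (Icc a b) τ‖ ≤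
        |∫ τ in x..t, (w τ * M + F τ)| := by
      refine intervalIntegral.norm_integral_le_abs_of_norm_le ?_ ((hwi.mul_const M).add hFi)
      rw [ae_restrict_iff' measurableSet_uIoc]
      exact Eventually.of_forall fun τ hτ => hder i j τ (hsub (uIoc_subset_uIcc hτ))
    rw [← (hyj i j).sub_eq_integral hab.out hp.out hxI ht,
      intervalIntegral.integral_add (hwi.mul_const M) hFi, intervalIntegral.integral_mul_const]
      at h1
    have h2 : |∫ τ in x..t, F τ| ≤ ∫ τ in a..b, F τ := by
      rw [intervalIntegral.integral_of_le hab.out.le, ← integral_Icc_eq_integral_Ioc]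
      refine (intervalIntegral.norm_integral_le_integral_norm_uIoc (f := F)).trans ?_
      simp only [Real.norm_of_nonneg (hF0 _)]
      exact setIntegral_mono_set hFint (Eventually.of_forall hF0)
        (uIoc_subset_uIcc.trans hsub).eventuallyLE
    have h3 := abs_add_le ((∫ τ in x..t, w τ) * M) (∫ τ in x..t, F τ)
    rw [abs_mul, abs_of_nonneg hM0] at h3
    have h4 := norm_add_le (iteratedDerivWithin j (y i) (Icc a b) x)
      (iteratedDerivWithin j (y i) (Icc a b) t - iteratedDerivWithin j (y i) (Icc a b) x)
    rw [add_sub_cancel] at h4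
    linarith [mul_le_mul_of_nonneg_right hx hM0]
  have hsum : M ≤ g x + N * (ε * M + ∫ τ in a..b, F τ) := by
    calc M ≤ ∑ i : Fin m, ∑ j : Fin r, (‖iteratedDerivWithin j (y i) (Icc a b) x‖ +
          (ε * M + ∫ τ in a..b, F τ)) :=
          Finset.sum_le_sum fun i _ => Finset.sum_le_sum fun j _ => hinc i j
      _ = g x + N * (ε * M + ∫ τ in a..b, F τ) := by
          simp only [Finset.sum_add_distrib, Finset.sum_const, Finset.card_univ, Fintype.card_fin,
            nsmul_eq_mul, g, hN]
          ring
  have hdata : g x ≤ dataNorm a b r T y :=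
    Finset.single_le_sum (f := g) (fun _ _ => Finset.sum_nonneg fun _ _ =>
      Finset.sum_nonneg fun _ _ => norm_nonneg _) hxT
  have hFle : ∫ τ in a..b, F τ ≤ K * ∑ i, sobolevNorm a b p 0 (diffExpr a b A y i) := by
    rw [hF, intervalIntegral.integral_finsetSum, Finset.mul_sum]
    · refine Finset.sum_le_sum fun i _ => ?_
      rw [sobolevNorm_zero]
      exact HK _ (hf i)
    · exact fun i _ => (intervalIntegrable_of_memLp hp.out (hf i) (left_mem_Icc.2 hab.out.le)
        (right_mem_Icc.2 hab.out.le)).norm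
  refine ((hgle i₀ j₀ t₀).trans (hmax ht₀)).trans ?_
  have hS0 : 0 ≤ ∑ i, sobolevNorm a b p 0 (diffExpr a b A y i) :=
    Finset.sum_nonneg fun _ _ => sobolevNorm_nonneg
  have hD0 : 0 ≤ dataNorm a b r T y := dataNorm_nonneg
  change M ≤ _
  nlinarith [mul_le_mul_of_nonneg_right hNε hM0, mul_le_mul_of_nonneg_left hFle hN0,
    mul_nonneg (mul_nonneg hN0 hK) hD0]

/-- The equation expresses the highest derivative through the lower ones. -/
theorem sobolevNorm_iteratedDerivWithin_le_of_diffExpr {A : Fin r → Fin m → Fin m → ℝ → ℂ}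
    (hA : ∀ j i i', IsSobolev a b p n (A j i i')) {y : Fin m → ℝ → ℂ}
    (hy : ∀ i, IsSobolev a b p (n + r) (y i)) (i : Fin m) :
    sobolevNorm a b p n (iteratedDerivWithin r (y i) (Icc a b)) ≤
      sobolevNorm a b p n (diffExpr a b A y i) + ∑ j : Fin r, ∑ i' : Fin m,
        sobolevNorm a b p n (A j i i' * iteratedDerivWithin j (y i') (Icc a b)) := by
  have h1 : ∀ (j : Fin r) (i' : Fin m),
      IsSobolev a b p n (A j i i' * iteratedDerivWithin j (y i') (Icc a b)) := fun j i' =>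
    IsSobolev.mul hab.out (hA j i i') ((hy i').iteratedDerivWithin_of_lt j.2)
  have h2 := fun j => IsSobolev.sum hab.out Finset.univ (h1 j)
  have e : iteratedDerivWithin r (y i) (Icc a b) = diffExpr a b A y i -
      ∑ j : Fin r, ∑ i' : Fin m, A j i i' * iteratedDerivWithin j (y i') (Icc a b) := by
    simp [diffExpr, lowerOrderExpr]
  rw [e]
  refine (sobolevNorm_sub_le (isSobolev_diffExpr hA hy i)
    (IsSobolev.sum hab.out Finset.univ h2)).trans (add_le_add le_rfl ?_)
  exact (sobolevNorm_sum_le _ h2).trans (Finset.sum_le_sum fun j _ => sobolevNorm_sum_le _ (h1 j))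

/-- The a priori estimate: the norm of `y` in `(W_p^{n+r})^m` is controlled by `L y` in `(W_p^n)^m`
and finitely many Cauchy data of `y`. -/
theorem exists_sum_sobolevNorm_le (n : ℕ) (A : Fin r → Fin m → Fin m → ℝ → ℂ)
    (hA : ∀ j i i', IsSobolev a b p n (A j i i')) :
    ∃ T : Finset ℝ, (↑T : Set ℝ) ⊆ Icc a b ∧ ∃ C : ℝ, 0 ≤ C ∧ ∀ y : Fin m → ℝ → ℂ,
      (∀ i, IsSobolev a b p (n + r) (y i)) → ∀ i, sobolevNorm a b p (n + r) (y i) ≤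
        C * (∑ i, sobolevNorm a b p n (diffExpr a b A y i) + dataNorm a b r T y) := by
  induction n with
  | zero =>
    obtain ⟨T, hT, C, hC, H⟩ := exists_norm_iteratedDerivWithin_le A hA
    obtain ⟨K, hK, HK⟩ := exists_eLpNorm_toReal_le (a := a) (b := b) (p := p)
    have hAn : 0 ≤ ∑ i, ∑ j, ∑ i', sobolevNorm a b p 0 (A j i i') := Finset.sum_nonneg fun _ _ =>
      Finset.sum_nonneg fun _ _ => Finset.sum_nonneg fun _ _ => sobolevNorm_nonneg
    refine ⟨T, hT, r * (K * C) + 1 + C * ∑ i, ∑ j, ∑ i', sobolevNorm a b p 0 (A j i i'),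
      by positivity, fun y hy i => ?_⟩
    have hS0 : ∀ i, 0 ≤ sobolevNorm a b p 0 (diffExpr a b A y i) := fun i => sobolevNorm_nonneg
    have hD0 : 0 ≤ dataNorm a b r T y := dataNorm_nonneg
    have H' := H y (by simpa using hy)
    set S := ∑ i, sobolevNorm a b p 0 (diffExpr a b A y i) + dataNorm a b r T y with hS
    have hSn : 0 ≤ S := add_nonneg (Finset.sum_nonneg fun i _ => hS0 i) hD0
    have hCS : 0 ≤ C * S := mul_nonneg hC hSn
    have h1 : ∑ k ∈ Finset.range r,
        (eLpNorm (iteratedDerivWithin k (y i) (Icc a b)) p (intervalMeasure a b)).toReal ≤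
        r * (K * (C * S)) := by
      refine (Finset.sum_le_card_nsmul _ _ (K * (C * S)) fun k hk => ?_).trans (by simp)
      exact HK _ _ hCS (H' i ⟨k, Finset.mem_range.1 hk⟩)
    have h2 := sobolevNorm_iteratedDerivWithin_le_of_diffExpr hA hy i
    have h3 : sobolevNorm a b p 0 (diffExpr a b A y i) ≤ S :=
      (Finset.single_le_sum (fun i _ => hS0 i) (Finset.mem_univ i)).trans
        (le_add_of_nonneg_right hD0)
    have h4 : ∑ j : Fin r, ∑ i' : Fin m,
        sobolevNorm a b p 0 (A j i i' * iteratedDerivWithin j (y i') (Icc a b)) ≤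
        C * S * ∑ i, ∑ j, ∑ i', sobolevNorm a b p 0 (A j i i') := by
      refine le_trans ?_ (mul_le_mul_of_nonneg_left (Finset.single_le_sum
        (f := fun i => ∑ j, ∑ i', sobolevNorm a b p 0 (A j i i')) (fun _ _ =>
        Finset.sum_nonneg fun _ _ => Finset.sum_nonneg fun _ _ => sobolevNorm_nonneg)
        (Finset.mem_univ i)) hCS)
      simp only [Finset.mul_sum]
      refine Finset.sum_le_sum fun j _ => Finset.sum_le_sum fun i' _ => ?_
      rw [sobolevNorm_zero, sobolevNorm_zero]
      exact eLpNorm_mul_toReal_le hCS (hA j i i') (H' i' j)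
    rw [sobolevNorm_add_order]
    linarith
  | succ n ih =>
    obtain ⟨T, hT, C, hC, H⟩ := ih fun j i i' => (hA j i i').mono_succ hab.out
    obtain ⟨K, hK, HK⟩ := exists_sobolevNorm_succ_mul_le (a := a) (b := b) (p := p) n
    have hAn : 0 ≤ ∑ i, ∑ j, ∑ i', sobolevNorm a b p (n + 1) (A j i i') :=
      Finset.sum_nonneg fun _ _ => Finset.sum_nonneg fun _ _ => Finset.sum_nonneg fun _ _ =>
        sobolevNorm_nonneg
    refine ⟨T, hT, C + 1 + K * C * ∑ i, ∑ j, ∑ i', sobolevNorm a b p (n + 1) (A j i i'),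
      by positivity, fun y hy i => ?_⟩
    have hS0 : ∀ i, 0 ≤ sobolevNorm a b p (n + 1) (diffExpr a b A y i) := fun i =>
      sobolevNorm_nonneg
    have hD0 : 0 ≤ dataNorm a b r T y := dataNorm_nonneg
    have hy' : ∀ i, IsSobolev a b p (n + r) (y i) := fun i =>
      IsSobolev.mono_add hab.out 1 (by simpa [add_right_comm] using hy i)
    set S := ∑ i, sobolevNorm a b p (n + 1) (diffExpr a b A y i) + dataNorm a b r T y with hS
    have hSn : 0 ≤ S := add_nonneg (Finset.sum_nonneg fun i _ => hS0 i) hD0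
    have H' : ∀ i, sobolevNorm a b p (n + r) (y i) ≤ C * S := fun i =>
      (H y hy' i).trans (mul_le_mul_of_nonneg_left (add_le_add
        (Finset.sum_le_sum fun i _ => sobolevNorm_mono 1) le_rfl) hC)
    have hCS : 0 ≤ C * S := mul_nonneg hC hSn
    have h1 : ∑ k ∈ Finset.range r,
        (eLpNorm (iteratedDerivWithin k (y i) (Icc a b)) p (intervalMeasure a b)).toReal ≤
        C * S := by
      refine le_trans ?_ (H' i)
      rw [sobolevNorm_add_order]
      exact le_add_of_nonneg_right sobolevNorm_nonneg
    have h2 := sobolevNorm_iteratedDerivWithin_le_of_diffExpr hA hy i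
    have h3 : sobolevNorm a b p (n + 1) (diffExpr a b A y i) ≤ S :=
      (Finset.single_le_sum (fun i _ => hS0 i) (Finset.mem_univ i)).trans
        (le_add_of_nonneg_right hD0)
    have h4 : ∑ j : Fin r, ∑ i' : Fin m,
        sobolevNorm a b p (n + 1) (A j i i' * iteratedDerivWithin j (y i') (Icc a b)) ≤
        K * (C * S) * ∑ i, ∑ j, ∑ i', sobolevNorm a b p (n + 1) (A j i i') := by
      refine le_trans ?_ (mul_le_mul_of_nonneg_left (Finset.single_le_sum
        (f := fun i => ∑ j, ∑ i', sobolevNorm a b p (n + 1) (A j i i')) (fun _ _ =>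
        Finset.sum_nonneg fun _ _ => Finset.sum_nonneg fun _ _ => sobolevNorm_nonneg)
        (Finset.mem_univ i)) (mul_nonneg hK hCS))
      simp only [Finset.mul_sum]
      refine Finset.sum_le_sum fun j _ => Finset.sum_le_sum fun i' _ => ?_
      refine (HK _ _ (hA j i i') ((hy i').iteratedDerivWithin_of_lt j.2)).trans ?_
      rw [mul_assoc, mul_comm (sobolevNorm a b p (n + 1) (A j i i'))]
      refine mul_le_mul_of_nonneg_left (mul_le_mul_of_nonneg_right ?_ sobolevNorm_nonneg) hK
      exact (sobolevNorm_iteratedDerivWithin_le_of_lt j.2).trans (H' i')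
    rw [sobolevNorm_add_order]
    linarith

end APriori

/-! ### Stability of trivial kernels -/

section Abstract

variable {X F G : Type*} [SeminormedAddCommGroup X] [NormedSpace ℂ X] [CompleteSpace X]
  [NormedAddCommGroup F] [NormedSpace ℂ F] [ProperSpace F]
  [NormedAddCommGroup G] [NormedSpace ℂ G]

/-- Stability of trivial kernels. The seminorm `q` stands for `‖L x‖` and `P k x` for `L(k) x = 0`.
The estimate `hest` says that `(L, δ)` is bounded below, where `δ` has values in a space with
compact balls; together with the uniform boundedness of `B(k)` it makes normalized kernel elements
of `(L(k), B(k))` converge, along a subsequence, to a normalized kernel element of `(L, B)`. -/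
theorem eventually_norm_eq_zero_of_estimate (q : Seminorm ℂ X) (δ : X →L[ℂ] F) {C M : ℝ}
    (hest : ∀ x, ‖x‖ ≤ C * (q x + ‖δ x‖)) (hM : ∀ x, q x ≤ M * ‖x‖)
    {P : ℕ → X → Prop} {ε : ℕ → ℝ} (hε : Tendsto ε atTop (𝓝 0))
    (hP : ∀ k x, P k x → q x ≤ ε k * ‖x‖)
    {B : X →L[ℂ] G} {Bk : ℕ → X →L[ℂ] G}
    (hB : ∀ x, Tendsto (fun k => Bk k x) atTop (𝓝 (B x)))
    (htriv : ∀ x, q x = 0 → B x = 0 → ‖x‖ = 0) :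
    ∀ᶠ k in atTop, ∀ x, P k x → Bk k x = 0 → ‖x‖ = 0 := by
  by_contra hcon
  have hfreq : ∃ᶠ k in atTop, ∃ x, ‖x‖ = 1 ∧ q x ≤ ε k ∧ Bk k x = 0 := by
    refine (not_eventually.1 hcon).mono fun k hk => ?_
    push Not at hk
    obtain ⟨x, hx, hBx, hx0⟩ := hk
    refine ⟨((‖x‖⁻¹ : ℝ) : ℂ) • x, ?_, ?_, by rw [map_smul, hBx, smul_zero]⟩
    · rw [norm_smul, Complex.norm_real, norm_inv, norm_norm, inv_mul_cancel₀ hx0]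
    · rw [map_smul_eq_mul, Complex.norm_real, norm_inv, norm_norm, inv_mul_le_iff₀
        (lt_of_le_of_ne (norm_nonneg x) (Ne.symm hx0)), mul_comm]
      exact hP k x hx
  obtain ⟨φ, hφ, hx⟩ := extraction_of_frequently_atTop hfreq
  choose x hx1 hxq hxB using hx
  have hδ : ∀ k, δ (x k) ∈ Metric.closedBall (0 : F) ‖δ‖ := fun k => by
    simpa [hx1 k] using δ.le_opNorm (x k)
  obtain ⟨v, -, ψ, hψ, hv⟩ := (isCompact_closedBall (0 : F) ‖δ‖).tendsto_subseq hδ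
  have hqψ : Tendsto (fun k => q (x (ψ k))) atTop (𝓝 0) :=
    squeeze_zero (fun _ => apply_nonneg q _) (fun k => hxq (ψ k))
      (hε.comp (hφ.tendsto_atTop.comp hψ.tendsto_atTop))
  have hC : 0 ≤ C := by
    by_contra hC
    have h1 := hest (x 0)
    have h2 := mul_nonneg (neg_nonneg.2 (not_le.1 hC).le)
      (add_nonneg (apply_nonneg q (x 0)) (norm_nonneg (δ (x 0))))
    rw [hx1] at h1
    linarith
  -- `hest` is applied to differences: both `q (x (ψ k))` and the increments of `δ` are small.
  have hcauchy : CauchySeq (x ∘ ψ) := by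
    have h1 : CauchySeq fun k => δ (x (ψ k)) := hv.cauchySeq
    rw [Metric.cauchySeq_iff] at h1 ⊢
    intro η hη
    have hη' : 0 < η / (4 * (C + 1)) := by positivity
    obtain ⟨N₁, hN₁⟩ := h1 _ hη'
    obtain ⟨N₂, hN₂⟩ := eventually_atTop.1 (hqψ.eventually (gt_mem_nhds hη'))
    refine ⟨max N₁ N₂, fun j hj k hk => ?_⟩
    have e1 := hN₁ j (le_of_max_le_left hj) k (le_of_max_le_left hk)
    have e2 := hN₂ j (le_of_max_le_right hj)
    have e3 := hN₂ k (le_of_max_le_right hk)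
    have e4 := map_sub_le_add q (x (ψ j)) (x (ψ k))
    have e5 := hest (x (ψ j) - x (ψ k))
    rw [map_sub δ, ← dist_eq_norm, ← dist_eq_norm] at e5
    have e6 : C * (q (x (ψ j) - x (ψ k)) + dist (δ (x (ψ j))) (δ (x (ψ k)))) ≤
        C * (3 * (η / (4 * (C + 1)))) := mul_le_mul_of_nonneg_left (by linarith) hC
    refine (e5.trans e6).trans_lt ?_
    have : C * (3 * (η / (4 * (C + 1)))) = 3 / 4 * η * (C / (C + 1)) := by field_simp
    rw [this]
    have h2 : C / (C + 1) ≤ 1 := (div_le_one (by positivity)).2 (by linarith)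
    nlinarith
  obtain ⟨z, hz⟩ := cauchySeq_tendsto_of_complete hcauchy
  have hz1 : ‖z‖ = 1 := tendsto_nhds_unique hz.norm (by simp [hx1])
  have hd : Tendsto (fun k => ‖z - x (ψ k)‖) atTop (𝓝 0) := by
    simpa [dist_eq_norm, norm_sub_rev] using tendsto_iff_dist_tendsto_zero.1 hz
  have hqz : q z = 0 := by
    refine le_antisymm (ge_of_tendsto' ((hd.const_mul M).add hqψ |>.trans (by simp)) fun k => ?_)
      (apply_nonneg q z)
    have h1 := map_add_le_add q (z - x (ψ k)) (x (ψ k))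
    rw [sub_add_cancel] at h1
    exact h1.trans (add_le_add (hM _) le_rfl)
  have hBz : B z = 0 := by
    -- Strong convergence alone does not control `Bk` on the varying vectors `x (ψ k)`.
    obtain ⟨K, hK⟩ := banach_steinhaus (g := Bk) fun x =>
      let ⟨K, hK⟩ := (hB x).norm.bddAbove_range
      ⟨K, fun k => hK ⟨k, rfl⟩⟩
    have h1 : Tendsto (fun k => Bk (φ (ψ k)) z) atTop (𝓝 0) := by
      refine squeeze_zero_norm (fun k => ?_) (by simpa using hd.const_mul K)
      rw [← sub_zero (Bk (φ (ψ k)) z), ← hxB (ψ k), ← map_sub]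
      exact (Bk _).le_of_opNorm_le (hK _) _
    exact tendsto_nhds_unique
      ((hB z).comp (hφ.tendsto_atTop.comp hψ.tendsto_atTop)) h1
  have := htriv z hqz hBz
  rw [hz1] at this
  exact one_ne_zero this

end Abstract

/-! ### Convergence of the coefficients -/

section Coefficients

variable {a b : ℝ} [hab : Fact (a < b)] {p : ℝ≥0∞} {n m r : ℕ}

theorem derivWithin_ofReal_pow (j : ℕ) : EqOn (derivWithin (fun t : ℝ => (t : ℂ) ^ j) (Icc a b))
    ((j : ℂ) • fun t : ℝ => (t : ℂ) ^ (j - 1)) (Icc a b) := fun t ht => by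
  have h : HasDerivAt (fun t : ℝ => (t : ℂ) ^ j) (j * (t : ℂ) ^ (j - 1)) t :=
    (hasDerivAt_pow j (t : ℂ)).comp_ofReal
  exact h.hasDerivWithinAt.derivWithin (uniqueDiffOn_Icc hab.out t ht)

theorem isSobolev_ofReal_pow (s j : ℕ) : IsSobolev a b p (s + 1) (fun t : ℝ => (t : ℂ) ^ j) := by
  have hc : ContDiff ℝ 1 (fun t : ℝ => (t : ℂ) ^ j) := Complex.ofRealCLM.contDiff.pow j
  have hc' : ∀ j, Continuous (fun t : ℝ => (t : ℂ) ^ j) := fun j => Complex.continuous_ofReal.pow j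
  induction s generalizing j with
  | zero =>
    refine IsSobolev.one_iff.2 ⟨hc.contDiffOn.absolutelyContinuousOnInterval, ?_⟩
    exact IsSobolev.memLp_of_continuousOn
      (((hc' (j - 1)).const_smul (j : ℂ)).continuousOn.congr (derivWithin_ofReal_pow j))
  | succ s ih =>
    refine (IsSobolev.succ_succ_iff hab.out).2
      ⟨(hc.differentiable one_ne_zero).differentiableOn, ?_⟩
    exact ((ih (j - 1) (Complex.ofRealCLM.contDiff.pow _)).const_smul (j : ℂ)).congr hab.out
      (derivWithin_ofReal_pow j)

theorem iteratedDerivWithin_ofReal_pow (k j : ℕ) :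
    EqOn (iteratedDerivWithin k (fun t : ℝ => (t : ℂ) ^ j) (Icc a b))
      (fun t => (j.descFactorial k : ℂ) * (t : ℂ) ^ (j - k)) (Icc a b) := by
  induction k with
  | zero => intro t _; simp
  | succ k ih =>
    intro t ht
    rw [iteratedDerivWithin_succ, derivWithin_congr ih (ih ht)]
    have e : (fun t : ℝ => (j.descFactorial k : ℂ) * (t : ℂ) ^ (j - k)) =
      (j.descFactorial k : ℂ) • fun t : ℝ => (t : ℂ) ^ (j - k) := rfl
    rw [e, derivWithin_const_smul_field, derivWithin_ofReal_pow (j - k) ht,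
      Nat.descFactorial_succ]
    simp only [Pi.smul_apply, smul_eq_mul, Nat.cast_mul, Nat.sub_sub]
    ring

variable [hp : Fact (1 ≤ p)]

/-- The lower-order expression is bounded by the size of its coefficients in `W_p^n`. -/
theorem exists_sobolevNorm_lowerOrderExpr_le : ∃ K : ℝ, 0 ≤ K ∧
    ∀ A : Fin r → Fin m → Fin m → ℝ → ℂ, (∀ j i i', IsSobolev a b p n (A j i i')) →
      ∀ y : Fin m → ℝ → ℂ, (∀ i, IsSobolev a b p (n + r) (y i)) →
        ∀ c : ℝ, (∀ i, sobolevNorm a b p (n + r) (y i) ≤ c) → ∀ i,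
          sobolevNorm a b p n (lowerOrderExpr a b A y i) ≤
            K * (∑ j, ∑ i', sobolevNorm a b p n (A j i i')) * c := by
  obtain ⟨K, hK, H⟩ := exists_sobolevNorm_mul_le (a := a) (b := b) (p := p) n
  refine ⟨K, hK, fun A hA y hy c hc i => ?_⟩
  have hu := fun (i : Fin m) (j : Fin r) => (hy i).iteratedDerivWithin_of_lt j.2
  have hAu := fun (j : Fin r) (i' : Fin m) => IsSobolev.mul hab.out (hA j i i') (hu i' j)
  refine (sobolevNorm_sum_le _ fun j => IsSobolev.sum hab.out Finset.univ (hAu j)).trans ?_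
  rw [Finset.mul_sum, Finset.sum_mul]
  refine Finset.sum_le_sum fun j _ => (sobolevNorm_sum_le _ (hAu j)).trans ?_
  rw [Finset.mul_sum, Finset.sum_mul]
  refine Finset.sum_le_sum fun i' _ => (H _ _ (hA j i i') (hu i' j)).trans ?_
  rw [mul_assoc]
  refine mul_le_mul_of_nonneg_left (mul_le_mul_of_nonneg_left ?_ sobolevNorm_nonneg) hK
  exact (sobolevNorm_iteratedDerivWithin_le_of_lt j.2).trans (hc i')

/-- If the expressions with coefficients `D k` tend to zero on every fixed function, then so do the
coefficients. On the monomial `t ^ j` in the component `i'` only the coefficients of order at most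
`j` contribute, and the one of order `j` is multiplied by a nonzero constant. -/
theorem tendsto_sobolevNorm_coefficient {D : ℕ → Fin r → Fin m → Fin m → ℝ → ℂ}
    (hD : ∀ k j i i', IsSobolev a b p n (D k j i i'))
    (h : ∀ y : Fin m → ℝ → ℂ, (∀ i, IsSobolev a b p (n + r) (y i)) → ∀ i,
      Tendsto (fun k => sobolevNorm a b p n (lowerOrderExpr a b (D k) y i)) atTop (𝓝 0))
    (j : Fin r) (i i' : Fin m) :
    Tendsto (fun k => sobolevNorm a b p n (D k j i i')) atTop (𝓝 0) := by
  obtain ⟨K, hK, H⟩ := exists_sobolevNorm_mul_le (a := a) (b := b) (p := p) n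
  induction j using WellFoundedLT.induction with
  | ind j ih =>
    set P : ℝ → ℂ := fun t => (t : ℂ) ^ (j : ℕ) with hPdef
    have hP : IsSobolev a b p (n + r) P := by
      have e : n + r = n + (r - 1) + 1 := by have := j.2; omega
      rw [e]
      exact isSobolev_ofReal_pow _ _
    have hPj := fun j' : Fin r => hP.iteratedDerivWithin_of_lt j'.2
    have hfac : ((j : ℕ).factorial : ℂ) ≠ 0 := by exact_mod_cast (j : ℕ).factorial_ne_zero
    set y : Fin m → ℝ → ℂ := Pi.single i' P with hy_def
    have hy : ∀ i, IsSobolev a b p (n + r) (y i) := fun i => by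
      rcases eq_or_ne i i' with rfl | hi
      · simpa [hy_def] using hP
      · simpa [hy_def, hi] using IsSobolev.zero
    have hlow : ∀ k, lowerOrderExpr a b (D k) y i =
        ∑ j' : Fin r, D k j' i i' * iteratedDerivWithin j' P (Icc a b) := fun k => by
      refine Finset.sum_congr rfl fun j' _ => ?_
      rw [Finset.sum_eq_single i']
      · simp [hy_def]
      · intro i'' _ hi
        have : iteratedDerivWithin j' (0 : ℝ → ℂ) (Icc a b) = 0 := by funext t; simp
        simp [hy_def, hi, this]
      · simp
    have hsplit : ∀ k, EqOn (((j : ℕ).factorial : ℂ) • D k j i i')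
        (lowerOrderExpr a b (D k) y i -
          ∑ j' ∈ Finset.univ.filter (· < j), D k j' i i' * iteratedDerivWithin j' P (Icc a b))
        (Icc a b) := by
      intro k t ht
      -- Of the orders from `j` on only `j` itself survives, as `P^{(j')} = 0` for `j' > j`.
      rw [hlow, ← Finset.sum_filter_add_sum_filter_not Finset.univ (· < j), add_sub_cancel_left,
        Finset.sum_apply, Finset.sum_eq_single j]
      · simp [iteratedDerivWithin_ofReal_pow _ _ ht, P, Nat.descFactorial_self, mul_comm]
      · intro j' hj' hne
        have : j < j' := lt_of_le_of_ne (by simpa using hj') hne.symm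
        simp [iteratedDerivWithin_ofReal_pow _ _ ht, P,
          Nat.descFactorial_eq_zero_iff_lt.2 (Fin.lt_def.1 this)]
      · simp
    have hbound : ∀ k, ‖((j : ℕ).factorial : ℂ)‖ * sobolevNorm a b p n (D k j i i') ≤
        sobolevNorm a b p n (lowerOrderExpr a b (D k) y i) +
          ∑ j' ∈ Finset.univ.filter (· < j), K * (sobolevNorm a b p n (D k j' i i') *
            sobolevNorm a b p (n + 1) (iteratedDerivWithin j' P (Icc a b))) := by
      intro k
      have hm := fun j' : Fin r => IsSobolev.mul hab.out (hD k j' i i') (hPj j')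
      rw [← sobolevNorm_const_smul, sobolevNorm_congr (hsplit k)]
      refine (sobolevNorm_sub_le (isSobolev_lowerOrderExpr (hD k) hy i)
        (IsSobolev.sum hab.out _ hm)).trans (add_le_add le_rfl ?_)
      exact (sobolevNorm_sum_le _ hm).trans
        (Finset.sum_le_sum fun j' _ => H _ _ (hD k j' i i') (hPj j'))
    have hlim : Tendsto (fun k => sobolevNorm a b p n (lowerOrderExpr a b (D k) y i) +
          ∑ j' ∈ Finset.univ.filter (· < j), K * (sobolevNorm a b p n (D k j' i i') *
            sobolevNorm a b p (n + 1) (iteratedDerivWithin j' P (Icc a b)))) atTop (𝓝 0) := by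
      have h2 := tendsto_finsetSum (Finset.univ.filter (· < j)) fun j' hj' =>
        ((ih j' (Finset.mem_filter.1 hj').2).mul_const
          (sobolevNorm a b p (n + 1) (iteratedDerivWithin j' P (Icc a b)))).const_mul K
      simpa using (h y hy i).add h2
    refine squeeze_zero (fun _ => sobolevNorm_nonneg) (fun k => ?_)
      (by simpa only [mul_zero] using hlim.const_mul ‖((j : ℕ).factorial : ℂ)‖⁻¹)
    rw [le_inv_mul_iff₀ (norm_pos_iff.2 hfac)]
    exact hbound k

end Coefficients

/-! ### The boundary-value problem -/

section Assembly

variable {a b : ℝ} {p : ℝ≥0∞} {n m r l : ℕ}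

theorem diffExpr_smul (A : Fin r → Fin m → Fin m → ℝ → ℂ) (c : ℂ) (y : Fin m → ℝ → ℂ)
    (i : Fin m) : diffExpr a b A (fun i => c • y i) i = c • diffExpr a b A y i := by
  have e : ∀ k i, iteratedDerivWithin k (c • y i) (Icc a b) =
      c • iteratedDerivWithin k (y i) (Icc a b) := fun k i => by
    funext t
    exact iteratedDerivWithin_const_smul_field c _
  simp only [diffExpr, lowerOrderExpr, e, smul_add, Finset.smul_sum, mul_smul_comm]

variable [hab : Fact (a < b)]

/-- The coefficients of a differential expression as plain functions. -/
def coeffFun (A : Fin r → Matrix (Fin m) (Fin m) (SobolevSpace a b p n)) :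
    Fin r → Fin m → Fin m → ℝ → ℂ := fun j i i' => A j i i'

theorem isSobolev_coeffFun (A : Fin r → Matrix (Fin m) (Fin m) (SobolevSpace a b p n))
    (j : Fin r) (i i' : Fin m) : IsSobolev a b p n (coeffFun A j i i') := (A j i i').isSobolev

theorem diffOp_apply (A : Fin r → Matrix (Fin m) (Fin m) (SobolevSpace a b p n))
    (y : Fin m → SobolevSpace a b p (n + r)) (i : Fin m) :
    (diffOp A y i : ℝ → ℂ) = diffExpr a b (coeffFun A) (fun i => y i) i := rfl

theorem IsSobolev.eqOn_zero_of_ae {s : ℕ} {y : ℝ → ℂ} (hy : IsSobolev a b p (s + 1) y)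
    (h : y =ᵐ[intervalMeasure a b] 0) : EqOn y 0 (Icc a b) :=
  Measure.eqOn_Icc_of_ae_eq volume hab.out.ne h hy.continuousOn continuousOn_const

theorem eqOn_iteratedDerivWithin_add {j : ℕ} (hj : j < r) {y z : ℝ → ℂ}
    (hy : IsSobolev a b p (n + r) y) (hz : IsSobolev a b p (n + r) z) :
    EqOn (iteratedDerivWithin j (y + z) (Icc a b))
      (iteratedDerivWithin j y (Icc a b) + iteratedDerivWithin j z (Icc a b)) (Icc a b) :=
  Measure.eqOn_Icc_of_ae_eq volume hab.out.ne
    (IsSobolev.iteratedDerivWithin_add_ae hab.out (by omega) hy hz)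
    ((hy.add hab.out hz).iteratedDerivWithin_of_lt hj).continuousOn
    ((hy.iteratedDerivWithin_of_lt hj).continuousOn.add
      (hz.iteratedDerivWithin_of_lt hj).continuousOn)

theorem diffExpr_add_ae (A : Fin r → Fin m → Fin m → ℝ → ℂ) {y z : Fin m → ℝ → ℂ}
    (hy : ∀ i, IsSobolev a b p (n + r) (y i)) (hz : ∀ i, IsSobolev a b p (n + r) (z i))
    (i : Fin m) : diffExpr a b A (fun i => y i + z i) i =ᵐ[intervalMeasure a b]
      diffExpr a b A y i + diffExpr a b A z i := by
  filter_upwards [IsSobolev.iteratedDerivWithin_add_ae hab.out (Nat.le_add_left r n) (hy i) (hz i),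
    ae_restrict_mem measurableSet_Icc] with t h1 ht
  have e : ∀ (j : Fin r) (i' : Fin m), iteratedDerivWithin j (y i' + z i') (Icc a b) t =
      iteratedDerivWithin j (y i') (Icc a b) t + iteratedDerivWithin j (z i') (Icc a b) t :=
    fun j i' => eqOn_iteratedDerivWithin_add j.2 (hy i') (hz i') ht
  simp only [diffExpr, lowerOrderExpr, Pi.add_apply, Finset.sum_apply, Pi.mul_apply, h1, e,
    mul_add, Finset.sum_add_distrib]
  ring

variable [hp : Fact (1 ≤ p)]

/-- The seminorm `y ↦ ∑_i ‖(L y)_i‖_{n,p}` on `(W_p^{n+r})^m`. -/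
noncomputable def diffSeminorm (A : Fin r → Matrix (Fin m) (Fin m) (SobolevSpace a b p n)) :
    Seminorm ℂ (Fin m → SobolevSpace a b p (n + r)) :=
  Seminorm.of
    (fun y => ∑ i, sobolevNorm a b p n (diffExpr a b (coeffFun A) (fun i => y i) i))
    (fun y z => by
      rw [← Finset.sum_add_distrib]
      refine Finset.sum_le_sum fun i _ => ?_
      have hy := fun i => (y i).isSobolev
      have hz := fun i => (z i).isSobolev
      have h1 := isSobolev_diffExpr (isSobolev_coeffFun A) hy i
      have h2 := isSobolev_diffExpr (isSobolev_coeffFun A) hz i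
      refine le_trans (le_of_eq ?_) (sobolevNorm_add_le h1 h2)
      exact sobolevNorm_congr_ae
        (isSobolev_diffExpr (isSobolev_coeffFun A) (fun i => ((y + z) i).isSobolev) i)
        (h1.add hab.out h2) (diffExpr_add_ae _ hy hz i))
    (fun c y => by
      rw [Finset.mul_sum]
      refine Finset.sum_congr rfl fun i _ => ?_
      rw [← sobolevNorm_const_smul, ← diffExpr_smul]
      rfl)

theorem diffSeminorm_apply (A : Fin r → Matrix (Fin m) (Fin m) (SobolevSpace a b p n))
    (y : Fin m → SobolevSpace a b p (n + r)) : diffSeminorm A y =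
      ∑ i, sobolevNorm a b p n (diffExpr a b (coeffFun A) (fun i => y i) i) := rfl

theorem diffSeminorm_eq_zero_iff (A : Fin r → Matrix (Fin m) (Fin m) (SobolevSpace a b p n))
    (y : Fin m → SobolevSpace a b p (n + r)) : diffSeminorm A y = 0 ↔
      ∀ i, (diffOp A y i : ℝ → ℂ) =ᵐ[intervalMeasure a b] 0 := by
  rw [diffSeminorm_apply, Finset.sum_eq_zero_iff_of_nonneg fun _ _ => sobolevNorm_nonneg]
  simp only [Finset.mem_univ, forall_const, diffOp_apply]
  exact forall_congr' fun i => sobolevNorm_eq_zero_iff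
    (isSobolev_diffExpr (isSobolev_coeffFun A) (fun i => (y i).isSobolev) i)

/-- Solutions of the homogeneous problem in the sense of `IsSolution` are the kernel elements of
the seminorm `diffSeminorm` and of the boundary operator. -/
theorem isSolution_zero_iff (A : Fin r → Matrix (Fin m) (Fin m) (SobolevSpace a b p n))
    (B : (Fin m → SobolevSpace a b p (n + r)) →L[ℂ] (Fin l → ℂ))
    (y : Fin m → SobolevSpace a b p (n + r)) :
    IsSolution A B 0 0 y ↔ diffSeminorm A y = 0 ∧ B y = 0 := by
  have hres : intervalMeasure a b = volume.restrict (Ioo a b) :=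
    Measure.restrict_congr_set Ioo_ae_eq_Icc.symm
  rw [diffSeminorm_eq_zero_iff]
  constructor
  · rintro ⟨h1, h0, hB⟩
    refine ⟨fun i => ?_, hB⟩
    rw [hres]
    rcases Nat.eq_zero_or_pos n with hn | hn
    · filter_upwards [h0 hn] with t ht using ht i
    · filter_upwards [ae_restrict_mem measurableSet_Ioo] with t ht using h1 hn t ht i
  · rintro ⟨h, hB⟩
    refine ⟨fun hn t ht i => ?_, fun _ => ?_, hB⟩
    · obtain ⟨s, rfl⟩ := Nat.exists_eq_add_of_le' hn
      exact (diffOp A y i).isSobolev.eqOn_zero_of_ae (h i) (Ioo_subset_Icc_self ht)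
    · rw [← hres]
      exact ae_all_iff.2 h

theorem norm_eq_zero_iff_eqOn (hr : 1 ≤ r) (y : Fin m → SobolevSpace a b p (n + r)) :
    ‖y‖ = 0 ↔ ∀ i, ∀ t ∈ Icc a b, y i t = 0 := by
  have h1 : ‖y‖ = 0 ↔ ∀ i, ‖y i‖ = 0 := by
    constructor
    · exact fun h i => le_antisymm (h ▸ norm_le_pi_norm y i) (norm_nonneg _)
    · exact fun h => le_antisymm
        ((pi_norm_le_iff_of_nonneg le_rfl).2 fun i => (h i).le) (norm_nonneg _)
  rw [h1]
  refine forall_congr' fun i => ?_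
  obtain ⟨q, rfl⟩ := Nat.exists_eq_add_of_le' hr
  rw [SobolevSpace.norm_eq_sobolevNorm]
  constructor
  · intro h
    exact (y i).isSobolev.eqOn_zero_of_ae ((sobolevNorm_eq_zero_iff (y i).isSobolev).1 h)
  · intro h
    exact (sobolevNorm_congr (z := 0) h).trans sobolevNorm_zero_fun

theorem hasOnlyTrivialSolution_iff (hr : 1 ≤ r)
    (A : Fin r → Matrix (Fin m) (Fin m) (SobolevSpace a b p n))
    (B : (Fin m → SobolevSpace a b p (n + r)) →L[ℂ] (Fin l → ℂ)) :
    HasOnlyTrivialSolution A B ↔ ∀ y, diffSeminorm A y = 0 → B y = 0 → ‖y‖ = 0 := by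
  simp only [HasOnlyTrivialSolution, isSolution_zero_iff, norm_eq_zero_iff_eqOn hr, and_imp]

/-- The value of the `j`-th derivative, `j < r`, at a point of `[a, b]` as a continuous functional
on `W_p^{n+r}`. -/
theorem exists_evalDeriv {x : ℝ} (hx : x ∈ Icc a b) {j : ℕ} (hj : j < r) :
    ∃ f : SobolevSpace a b p (n + r) →L[ℂ] ℂ, ∀ y, f y = iteratedDerivWithin j y (Icc a b) x := by
  obtain ⟨K, hK, H⟩ := exists_norm_le_sobolevNorm (p := p) hab.out hp.out
  let f : SobolevSpace a b p (n + r) →ₗ[ℂ] ℂ :=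
    { toFun := fun y => iteratedDerivWithin j y (Icc a b) x
      map_add' := fun y z => eqOn_iteratedDerivWithin_add hj y.isSobolev z.isSobolev hx
      map_smul' := fun c y => iteratedDerivWithin_const_smul_field c _ }
  refine ⟨f.mkContinuous K fun y => ?_, fun y => rfl⟩
  have h1 := y.isSobolev.iteratedDerivWithin_of_lt hj
  refine (H _ (h1.one_of_succ hab.out) x hx).trans (mul_le_mul_of_nonneg_left ?_ hK)
  exact (sobolevNorm_one_le (s := n)).trans (sobolevNorm_iteratedDerivWithin_le_of_lt hj)

/-- The a priori estimate in operator form: modulo a continuous map to a finite-dimensional space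
the operator `L` is bounded below. -/
theorem exists_data_estimate (A : Fin r → Matrix (Fin m) (Fin m) (SobolevSpace a b p n)) :
    ∃ (ι : Type) (_ : Fintype ι) (δ : (Fin m → SobolevSpace a b p (n + r)) →L[ℂ] (ι → ℂ)) (C : ℝ),
      ∀ y, ‖y‖ ≤ C * (diffSeminorm A y + ‖δ y‖) := by
  obtain ⟨T, hT, C, hC, H⟩ := exists_sum_sobolevNorm_le n (coeffFun A) (isSobolev_coeffFun A)
  choose f hf using fun (x : T) (j : Fin r) =>
    exists_evalDeriv (a := a) (b := b) (p := p) (n := n) (hT x.2) j.2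
  let δ : (Fin m → SobolevSpace a b p (n + r)) →L[ℂ] ((T × Fin m × Fin r) → ℂ) :=
    ContinuousLinearMap.pi fun c => (f c.1 c.2.2).comp (ContinuousLinearMap.proj c.2.1)
  set N : ℝ := (T.card : ℝ) * (m * r) with hN
  have hN0 : 0 ≤ N := by positivity
  refine ⟨T × Fin m × Fin r, inferInstance, δ, C * (1 + N), fun y => ?_⟩
  have hdata : dataNorm a b r T (fun i => (y i : ℝ → ℂ)) ≤ N * ‖δ y‖ := by
    have h1 : ∀ x ∈ T, ∑ i : Fin m, ∑ j : Fin r, ‖iteratedDerivWithin j (y i) (Icc a b) x‖ ≤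
        m * r * ‖δ y‖ := by
      intro x hx
      refine (Finset.sum_le_sum fun i _ => Finset.sum_le_sum fun (j : Fin r) _ =>
        (?_ : _ ≤ ‖δ y‖)).trans (le_of_eq ?_)
      · rw [← hf ⟨x, hx⟩ j (y i)]
        exact norm_le_pi_norm (δ y) (⟨x, hx⟩, i, j)
      · simp [mul_assoc]
    refine (Finset.sum_le_sum h1).trans (le_of_eq ?_)
    simp [hN, mul_assoc]
  have hq : 0 ≤ diffSeminorm A y := apply_nonneg _ _
  have h2 : C * (diffSeminorm A y + N * ‖δ y‖) ≤ C * (1 + N) * (diffSeminorm A y + ‖δ y‖) := by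
    rw [mul_assoc C]
    refine mul_le_mul_of_nonneg_left ?_ hC
    nlinarith [mul_nonneg hN0 hq, norm_nonneg (δ y)]
  refine (pi_norm_le_iff_of_nonneg (le_trans (by positivity) h2)).2 fun i => le_trans ?_ h2
  refine (H _ (fun i => (y i).isSobolev) i).trans (mul_le_mul_of_nonneg_left ?_ hC)
  exact add_le_add le_rfl hdata

theorem sobolevNorm_apply_le (y : Fin m → SobolevSpace a b p (n + r)) (i : Fin m) :
    sobolevNorm a b p (n + r) (y i) ≤ ‖y‖ := norm_le_pi_norm y i

theorem exists_diffSeminorm_le (A : Fin r → Matrix (Fin m) (Fin m) (SobolevSpace a b p n)) :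
    ∃ M : ℝ, ∀ y, diffSeminorm A y ≤ M * ‖y‖ := by
  obtain ⟨K, -, H⟩ := exists_sobolevNorm_lowerOrderExpr_le (a := a) (b := b) (p := p) (n := n)
    (m := m) (r := r)
  refine ⟨∑ i, (1 + K * ∑ j, ∑ i', sobolevNorm a b p n (coeffFun A j i i')), fun y => ?_⟩
  rw [diffSeminorm_apply, Finset.sum_mul]
  refine Finset.sum_le_sum fun i _ => ?_
  have hy := fun i => (y i).isSobolev
  refine (sobolevNorm_add_le ((hy i).iteratedDerivWithin hab.out r)
    (isSobolev_lowerOrderExpr (isSobolev_coeffFun A) hy i)).trans ?_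
  rw [add_mul, one_mul]
  exact add_le_add ((sobolevNorm_iteratedDerivWithin_le r).trans (sobolevNorm_apply_le y i))
    (H _ (isSobolev_coeffFun A) _ hy _ (sobolevNorm_apply_le y) i)

/-- Strong convergence `L(k) → L` forces convergence of the coefficients in `W_p^n`. -/
theorem tendsto_coeffFun_sub {A : Fin r → Matrix (Fin m) (Fin m) (SobolevSpace a b p n)}
    {Ak : ℕ → Fin r → Matrix (Fin m) (Fin m) (SobolevSpace a b p n)}
    (h : ∀ y : Fin m → SobolevSpace a b p (n + r),
      Tendsto (fun k => diffOp (Ak k) y) atTop (𝓝 (diffOp A y)))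
    (j : Fin r) (i i' : Fin m) :
    Tendsto (fun k => sobolevNorm a b p n ((coeffFun A - coeffFun (Ak k)) j i i')) atTop (𝓝 0) := by
  refine tendsto_sobolevNorm_coefficient
    (fun k j i i' => (isSobolev_coeffFun A j i i').sub (isSobolev_coeffFun (Ak k) j i i'))
    (fun y hy i => ?_) j i i'
  have h1 := tendsto_pi_nhds.1 (h fun i => SobolevSpace.of (hy i)) i
  rw [tendsto_iff_dist_tendsto_zero] at h1
  refine h1.congr fun k => ?_
  rw [dist_comm, SobolevSpace.dist_def, diffOp_apply, diffOp_apply, diffExpr_sub]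
  rfl

/-- Convergence of the coefficients makes `L(k) → L` uniform on bounded sets. -/
theorem exists_diffSeminorm_le_of_tendsto
    {A : Fin r → Matrix (Fin m) (Fin m) (SobolevSpace a b p n)}
    {Ak : ℕ → Fin r → Matrix (Fin m) (Fin m) (SobolevSpace a b p n)}
    (h : ∀ y : Fin m → SobolevSpace a b p (n + r),
      Tendsto (fun k => diffOp (Ak k) y) atTop (𝓝 (diffOp A y))) :
    ∃ ε : ℕ → ℝ, Tendsto ε atTop (𝓝 0) ∧
      ∀ k y, diffSeminorm A y ≤ diffSeminorm (Ak k) y + ε k * ‖y‖ := by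
  obtain ⟨K, -, H⟩ := exists_sobolevNorm_lowerOrderExpr_le (a := a) (b := b) (p := p) (n := n)
    (m := m) (r := r)
  refine ⟨fun k => ∑ i, K * ∑ j, ∑ i',
    sobolevNorm a b p n ((coeffFun A - coeffFun (Ak k)) j i i'), ?_, fun k y => ?_⟩
  · have h1 := tendsto_finsetSum Finset.univ fun (i : Fin m) _ =>
      (tendsto_finsetSum Finset.univ fun (j : Fin r) _ => tendsto_finsetSum Finset.univ
        fun (i' : Fin m) _ => tendsto_coeffFun_sub h j i i').const_mul K
    simpa using h1
  · have hD : ∀ j i i', IsSobolev a b p n ((coeffFun A - coeffFun (Ak k)) j i i') :=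
      fun j i i' => (isSobolev_coeffFun A j i i').sub (isSobolev_coeffFun (Ak k) j i i')
    have hy := fun i => (y i).isSobolev
    rw [diffSeminorm_apply, diffSeminorm_apply, Finset.sum_mul, ← Finset.sum_add_distrib]
    refine Finset.sum_le_sum fun i _ => ?_
    have e : diffExpr a b (coeffFun A) (fun i => y i) i =
        diffExpr a b (coeffFun (Ak k)) (fun i => y i) i +
          lowerOrderExpr a b (coeffFun A - coeffFun (Ak k)) (fun i => y i) i := by
      rw [← diffExpr_sub, add_sub_cancel]
    rw [e]
    exact (sobolevNorm_add_le (isSobolev_diffExpr (isSobolev_coeffFun (Ak k)) hy i)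
      (isSobolev_lowerOrderExpr hD hy i)).trans
      (add_le_add le_rfl (H _ hD _ hy _ (sobolevNorm_apply_le y) i))

end Assembly

theorem corollary4 {a b : ℝ} [Fact (a < b)] {p : ℝ≥0∞} [Fact (1 ≤ p)]
    {n m r l : ℕ} (hm : 1 ≤ m) (hr : 1 ≤ r) (hl : 1 ≤ l)
    (A : Fin r → Matrix (Fin m) (Fin m) (SobolevSpace a b p n))
    (B : (Fin m → SobolevSpace a b p (n + r)) →L[ℂ] (Fin l → ℂ))
    (Ak : ℕ → Fin r → Matrix (Fin m) (Fin m) (SobolevSpace a b p n))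
    (Bk : ℕ → (Fin m → SobolevSpace a b p (n + r)) →L[ℂ] (Fin l → ℂ))
    (hconv : ∀ y : Fin m → SobolevSpace a b p (n + r),
      Tendsto (fun k => bvpOp (Ak k) (Bk k) y) atTop (𝓝 (bvpOp A B y)))
    (htriv : HasOnlyTrivialSolution A B) :
    ∀ᶠ k in atTop, HasOnlyTrivialSolution (Ak k) (Bk k) := by
  obtain ⟨ι, _, δ, C, hest⟩ := exists_data_estimate A
  obtain ⟨M, hM⟩ := exists_diffSeminorm_le A
  obtain ⟨ε, hε, hA⟩ := exists_diffSeminorm_le_of_tendsto fun y => (hconv y).fst_nhds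
  simp only [hasOnlyTrivialSolution_iff hr] at htriv ⊢
  refine eventually_norm_eq_zero_of_estimate (diffSeminorm A) δ hest hM
    (P := fun k y => diffSeminorm (Ak k) y = 0) hε (fun k y hy => ?_)
    (fun y => (hconv y).snd_nhds) htriv
  simpa [hy] using hA k y
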